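/- **Setting.** Let $\Theta_1,\Theta_2\subset\mathbb R^3$ be two disjoint, non-empty, smooth, compact, strictly convex obstacles (second fundamental form of the boundary bounded below by a positive constant), with outward unit normal $n$. Fix $\delta_1\ge 0$ and $y\in\mathbb R^3$. A *story of reflections* is a finite (possibly empty) sequence $J=(j_1,\dots,j_n)$ in $\{1,2\}$ with $j_i\ne j_{i+1}$. For $\xi\neq0$ put $\varphi_\emptyset(x,\xi)=(x-y)\cdot\xi/|\xi|$ on $\mathcal U_\emptyset=\mathbb R^3$. If $J=(J',j)$ and $\varphi=\varphi_{J'}(\cdot,\xi)$ is defined on $\mathcal U_{J'}$, let $\Gamma_J=\{p\in\partial\Theta_j\cap\mathcal U_{J'}:\ -n(p)\cdot\nabla\varphi(p)>\delta_1\}$, $\Xi(p)=\nabla\varphi(p)-2(\nabla\varphi(p)\cdot n(p))\,n(p)$, and define the reflected phase on $\mathcal U_J=\{p+\tau\,\Xi(p):p\in\Gamma_J,\ \tau\ge0\}$ by $\varphi_J(p+\tau\,\Xi(p),\xi)=\varphi(p)+\tau$. Put $$S_J(x,t,\xi)=\varphi_J(x,\xi)|\xi|-t\xi^2,$$ considered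 for those $\xi\ne0$ with $x\in\mathcal U_J$ (the set $\mathcal U_J$ depends on $\xi$). Say that $y$ is *behind* $\Theta_{j_1}$ for the direction $\xi$ if the open half-line $\{y-s\xi:s>0\}$ meets $\Theta_{j_1}$ (never, if $J=\emptyset$). Let $0<\alpha_0$, $0<\beta_0$, $0<\delta_0$, and let $q(x,\xi)$ be a smooth complex-valued symbol that vanishes unless $|\xi|\in[\alpha_0,\beta_0]$ and $d(x,\Theta_1\cup\Theta_2)\ge\delta_0$. Let $w^J=\sum_{k\ge0}h^kw^J_k(x,t,\xi)\,e^{-iS_J/h}$ be formal series whose coefficients are defined for $t\ge0$, $\xi\neq 0$, $x\in\mathcal U_J$, continuous in $(x,t)$, smooth in $(x,t)$ for $x$ in the interior of $\mathcal U_J$ and $t>0$, and satisfy there, with $w^J_{-1}=0$, $$(\partial_t+2|\xi|\nabla\varphi_J\cdot\nabla+|\xi|\Delta\varphi_J)\,w^J_k=-i\Delta w^J_{k-1},$$ together with $w^\emptyset_0|_{t=0}=q$ and $w^\emptyset_k|_{t=0}=0$ for $k\ge1$; and, for $J=(J',j)\neq\emptyset$, $w^J_k|_{t=0}=0$ and $w^J_k=w^{J'}_k$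 on $\Gamma_J$ for $t\geq 0$. We write $w^J(x,t,\xi)\ne0$ if $w^J_k(x,t,\xi)\neq0$ for some $k$. **Lemma 4.9.** 1. Let $J$ be a story of reflections, $x\in\mathbb R^3$, $t>0$. Then $S_J(x,t,\cdot)$ is $C^\infty$ near each $\xi\ne0$ with $x\in\mathcal U_J$, and it has at most one critical point $\xi$ for which $y$ is not behind $\Theta_{j_1}$. Moreover, for $\xi\neq0$ with $x\in\mathcal U_J$, the following are equivalent: $\xi$ is a critical point of $S_J(x,t,\cdot)$ for which $y$ is not behind $\Theta_{j_1}$; the ray that starts at $y$ with velocity $\xi$ and is reflected successively, non-tangentially and from outside, on $\Theta_{j_1},\dots,\Theta_{j_n}$ (other obstacles being ignored) is at $x$ at time $2t$, after these $n$ reflections. 2. At every critical point $\xi$ of $S_J(x,t,\cdot)$, $t>0$, with $w^J(x,t,\xi)\ne0$, $y$ is not behind $\Theta_{j_1}$. In particular there is at most one critical point with $w^J(x,t,\xi)\neq0$, and it corresponds to the ray from $y$ to $x$ in time $2t$ as in 1. 3. For all $t_0>0$ there is $c(t_0)>0$, depending only on $t_0$, the obstacles, $\delta_1$, $\alpha_0,\beta_0,\delta_0$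 (and not on $y$, $q$, $h$, $J$), such that for all stories $J$, all $t\ge t_0$ and all $x,\xi$ with $\xi\ne0$, $x\in\mathcal U_J$: $$w^J(x,t,\xi)\neq0\ \Longrightarrow\ |\det D^2_\xi S_J(x,t,\xi)|\ge c(t_0).$$ -/

import Mathlib

open scoped ContDiff

namespace TwoObstacles

/-- Euclidean three-space. -/
abbrev Space := EuclideanSpace ℝ (Fin 3)

/-- A non-empty smooth compact strictly convex obstacle `{g ≤ 0}`, presented by a smooth defining
function `g` with non-vanishing gradient on the boundary `{g = 0}`. Strict convexity means that the
second fundamental form of the boundary, `D²g(v, v) / |∇g|` on tangent vectors `v`, is bounded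
below by a positive constant times `|v|²`. -/
structure Obstacle where
  defFun : Space → ℝ
  smooth : ContDiff ℝ ∞ defFun
  nonempty : {x | defFun x ≤ 0}.Nonempty
  compact : IsCompact {x | defFun x ≤ 0}
  convex : Convex ℝ {x | defFun x ≤ 0}
  regular : ∀ x, defFun x = 0 → gradient defFun x ≠ 0
  curvature : ∃ κ : ℝ, 0 < κ ∧ ∀ x, defFun x = 0 → ∀ v : Space,
    inner ℝ (gradient defFun x) v = 0 →
      κ * ‖v‖ ^ 2 ≤ fderiv ℝ (fun z => fderiv ℝ defFun z v) x v / ‖gradient defFun x‖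

namespace Obstacle

/-- The obstacle as a set. -/
def carrier (Θ : Obstacle) : Set Space := {x | Θ.defFun x ≤ 0}

/-- The boundary of the obstacle. -/
def boundary (Θ : Obstacle) : Set Space := {x | Θ.defFun x = 0}

/-- The outward unit normal (at points of the boundary). -/
noncomputable def normal (Θ : Obstacle) (x : Space) : Space :=
  ‖gradient Θ.defFun x‖⁻¹ • gradient Θ.defFun x

/-- The law of reflection: the velocity after a reflection at the boundary point `p` with incoming
velocity `v`. -/
noncomputable def bounce (Θ : Obstacle) (p v : Space) : Space :=
  v - (2 * inner ℝ v (Θ.normal p)) • Θ.normal p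

end Obstacle

/-- A phase: a real function together with the set on which it is considered. -/
structure Phase where
  dom : Set Space
  val : Space → ℝ

/-- The plane-wave phase `x ↦ (x - y)·ξ / |ξ|`. -/
noncomputable def planePhase (y ξ : Space) : Phase where
  dom := Set.univ
  val x := inner ℝ (x - y) ξ / ‖ξ‖

namespace Phase

/-- The part of the boundary of `Θ` which the rays of `φ` hit from outside, with an angle of
incidence that is non-grazing, as quantified by `δ₁ ≥ 0`. -/
def incoming (Θ : Obstacle) (δ₁ : ℝ) (φ : Phase) : Set Space :=
  {p | p ∈ Θ.boundary ∧ p ∈ φ.dom ∧ δ₁ < -inner ℝ (Θ.normal p) (gradient φ.val p)}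

/-- `x` is reached from the boundary point `p`, after the length `τ`, by the ray of `φ`
reflected at `p`. -/
def Reaches (Θ : Obstacle) (δ₁ : ℝ) (φ : Phase) (x p : Space) (τ : ℝ) : Prop :=
  p ∈ φ.incoming Θ δ₁ ∧ 0 ≤ τ ∧ x = p + τ • Θ.bounce p (gradient φ.val p)

open Classical in
/-- The phase `φ_j` reflected on `Θ`: it is defined on the union of the reflected half-rays, and
`φ_j (p + τ Ξ) = φ p + τ` where `Ξ` is the reflected direction at `p`. -/
noncomputable def reflect (Θ : Obstacle) (δ₁ : ℝ) (φ : Phase) : Phase where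
  dom := {x | ∃ p τ, φ.Reaches Θ δ₁ x p τ}
  val x := if h : ∃ a : Space × ℝ, φ.Reaches Θ δ₁ x a.1 a.2
    then φ.val h.choose.1 + h.choose.2 else 0

end Phase

/-- A story of reflections: a finite sequence of obstacles without immediate repetition. -/
def IsStory (J : List (Fin 2)) : Prop := J.IsChain (· ≠ ·)

/-- The phase `φ_J(·, ξ)`, obtained from the plane-wave phase by successive reflections on
`Θ_{j₁}, …, Θ_{jₙ}`; its `dom` is the set `U_J`. -/
noncomputable def phase (Θ : Fin 2 → Obstacle) (δ₁ : ℝ) (y : Space) (J : List (Fin 2))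
    (ξ : Space) : Phase :=
  J.foldl (fun φ j => φ.reflect (Θ j) δ₁) (planePhase y ξ)

/-- The phase `S_J(x, t, ξ) = φ_J(x, ξ) |ξ| - t ξ²`. -/
noncomputable def actionPhase (Θ : Fin 2 → Obstacle) (δ₁ : ℝ) (y : Space) (J : List (Fin 2))
    (x : Space) (t : ℝ) (ξ : Space) : ℝ :=
  (phase Θ δ₁ y J ξ).val x * ‖ξ‖ - t * ‖ξ‖ ^ 2

/-- The frequencies `ξ ≠ 0` for which `φ_J(·, ξ)` is defined at `x`. -/
def frequencies (Θ : Fin 2 → Obstacle) (δ₁ : ℝ) (y : Space) (J : List (Fin 2)) (x : Space) :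
    Set Space :=
  {ξ | ξ ≠ 0 ∧ x ∈ (phase Θ δ₁ y J ξ).dom}

/-- `ξ` is a critical point of `S_J(x, t, ·)`. -/
def IsCritical (Θ : Fin 2 → Obstacle) (δ₁ : ℝ) (y : Space) (J : List (Fin 2)) (x : Space) (t : ℝ)
    (ξ : Space) : Prop :=
  ξ ∈ frequencies Θ δ₁ y J x ∧ HasGradientAt (actionPhase Θ δ₁ y J x t) 0 ξ

/-- The determinant of the Hessian matrix of `f` at `ξ`. -/
noncomputable def hessianDet (f : Space → ℝ) (ξ : Space) : ℝ :=
  (Matrix.of fun i j : Fin 3 =>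
    fderiv ℝ (fun η => fderiv ℝ f η (EuclideanSpace.single j 1)) ξ
      (EuclideanSpace.single i 1)).det

/-- The ray which starts at `z` with velocity `v` and is reflected successively on the obstacles in
the list (all other obstacles being ignored) is at the point `x` at time `T`, after all of these
reflections. Each reflection takes place at a point where the ray enters the obstacle
transversally, which is its first intersection with this convex obstacle. -/
def RayReaches (Θ : Fin 2 → Obstacle) : List (Fin 2) → Space → Space → ℝ → Space → Prop
  | [], z, v, T, x => 0 ≤ T ∧ x = z + T • v
  | j :: J, z, v, T, x => ∃ s : ℝ, 0 ≤ s ∧ z + s • v ∈ (Θ j).boundary ∧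
      inner ℝ v ((Θ j).normal (z + s • v)) < 0 ∧
      RayReaches Θ J (z + s • v) ((Θ j).bounce (z + s • v) v) (T - s) x

/-- `y` lies behind the first obstacle `Θ_{j₁}` for the direction `ξ`: the open half-line going
backwards from `y` meets `Θ_{j₁}`. (Never the case if the story is empty.) -/
def IsBehind (Θ : Fin 2 → Obstacle) (J : List (Fin 2)) (y ξ : Space) : Prop :=
  ∃ j ∈ J.head?, ∃ s : ℝ, 0 < s ∧ y - s • ξ ∈ (Θ j).carrier

/-- A smooth symbol supported in frequencies of size `[α₀, β₀]`, outside the obstacles and at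
distance at least `δ₀` of them. -/
structure IsSymbol (Θ : Fin 2 → Obstacle) (α₀ β₀ δ₀ : ℝ) (q : Space → Space → ℂ) : Prop where
  smooth : ContDiff ℝ ∞ (fun z : Space × Space => q z.1 z.2)
  frequency : ∀ x ξ, q x ξ ≠ 0 → ‖ξ‖ ∈ Set.Icc α₀ β₀
  away : ∀ x ξ, q x ξ ≠ 0 → δ₀ ≤ Metric.infDist x ((Θ 0).carrier ∪ (Θ 1).carrier)

/-- The transport operator `∂_t + 2|ξ| ∇φ·∇ + |ξ| Δφ` applied to `v` at `(x, t)`. -/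
noncomputable def transport (φ : Space → ℝ) (ξ : Space) (v : Space → ℝ → ℂ) (x : Space) (t : ℝ) :
    ℂ :=
  deriv (fun s => v x s) t
    + (2 * ‖ξ‖ : ℝ) * fderiv ℝ (fun z => v z t) x (gradient φ x)
    + (‖ξ‖ * Laplacian.laplacian φ x : ℝ) * v x t

/-- The family `w k J x t ξ` consists of the coefficients `w_k^J(x, t, ξ)`, in nonnegative times and
for `x ∈ U_J`, of the formal series `w^J = ∑ₖ hᵏ w_k^J exp(-i S_J / h)`: they solve the hierarchy of
transport equations, with initial data `q` for the empty story, and with zero initial data and the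
boundary condition `w^J = w^{J'}` on the last obstacle for the other ones. -/
structure IsAmplitude (Θ : Fin 2 → Obstacle) (δ₁ : ℝ) (y : Space) (q : Space → Space → ℂ)
    (w : ℕ → List (Fin 2) → Space → ℝ → Space → ℂ) : Prop where
  smooth : ∀ k J ξ, IsStory J → ξ ≠ 0 →
    ContDiffOn ℝ ∞ (fun z : Space × ℝ => w k J z.1 z.2 ξ)
      (interior (phase Θ δ₁ y J ξ).dom ×ˢ Set.Ioi 0)
  continuous : ∀ k J ξ, IsStory J → ξ ≠ 0 →
    ContinuousOn (fun z : Space × ℝ => w k J z.1 z.2 ξ) ((phase Θ δ₁ y J ξ).dom ×ˢ Set.Ici 0)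
  transport_zero : ∀ J ξ, IsStory J → ξ ≠ 0 → ∀ x ∈ interior (phase Θ δ₁ y J ξ).dom,
    ∀ t : ℝ, 0 < t →
      transport (phase Θ δ₁ y J ξ).val ξ (fun z s => w 0 J z s ξ) x t = 0
  transport_succ : ∀ k J ξ, IsStory J → ξ ≠ 0 → ∀ x ∈ interior (phase Θ δ₁ y J ξ).dom,
    ∀ t : ℝ, 0 < t →
      transport (phase Θ δ₁ y J ξ).val ξ (fun z s => w (k + 1) J z s ξ) x t
        = -Complex.I * Laplacian.laplacian (fun z => w k J z t ξ) x
  initial_nil_zero : ∀ x ξ, ξ ≠ 0 → w 0 [] x 0 ξ = q x ξ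
  initial_nil_succ : ∀ k x ξ, ξ ≠ 0 → w (k + 1) [] x 0 ξ = 0
  initial : ∀ k J ξ, IsStory J → J ≠ [] → ξ ≠ 0 → ∀ x ∈ (phase Θ δ₁ y J ξ).dom, w k J x 0 ξ = 0
  boundary : ∀ k J j ξ, IsStory (J ++ [j]) → ξ ≠ 0 →
    ∀ x ∈ (phase Θ δ₁ y J ξ).incoming (Θ j) δ₁, ∀ t : ℝ, 0 ≤ t →
      w k (J ++ [j]) x t ξ = w k J x t ξ

/-- The formal series `w^J(x, t, ξ)` is not zero. -/
def AmplitudeNonzero (w : ℕ → List (Fin 2) → Space → ℝ → Space → ℂ) (J : List (Fin 2))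
    (x : Space) (t : ℝ) (ξ : Space) : Prop :=
  ∃ k, w k J x t ξ ≠ 0

end TwoObstacles

open TwoObstacles

/-! ### Geometry of strictly convex obstacles -/

namespace TwoObstacles

open Filter Topology

namespace Obstacle

variable (Θ : Obstacle)

/-! Everything rests on a Fermat principle (`Ray.inner_sub_le`). For two rays with the same story,
going from `z` to `x` with length `T`, unit velocity `v` at the start and `V` at the end (primed for
the second ray), one has `⟨V, x' - x⟩ ≤ ⟨v, z' - z⟩ + (T' - T)`. A free flight of length `s'` of the
second ray loses `s' (1 - ⟨v, v'⟩) ≥ 0`, and a reflection loses a nonnegative amount because a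
convex obstacle lies on one side of its tangent planes. Exchanging the rays and adding gives
monotonicity, `⟨z' - z, v' - v⟩ ≤ ⟨x' - x, V' - V⟩`; by strict convexity, equality yields uniqueness
of rays.

The phase is the optical length of the ray of direction `ξ` ending at `x`. To make it independent of
whether `y` lies in front of the first obstacle, only the `Path` from the first reflection point `z`
to `x`, of length `T`, is used. Paths depend smoothly on the data, by the inverse function theorem
(`flowMap_injective`), and the Fermat principle says that suitable functions are minimal, so that
the derivatives of `z` and `T` drop out: with `u = ξ/|ξ|`, the spatial gradient of the phase is `V`,
and the gradient of the action in `ξ` is `z + T u - y - 2tξ`. A critical point is thus a ray whose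
straight backward prolongation is at `y` at time zero. It is a true ray from `y` when `2t|ξ| ≥ T`;
otherwise `z` itself lies behind `y`.

Monotonicity with fixed endpoint `x` bounds the quadratic form of the derivative of `z + T u` by
`T/|ξ|`, so minus the Hessian of the action is at least `2t - T/|ξ|`. The amplitudes are transported
along the rays (`IsAmplitude.eq_zero`), so where they do not vanish the prolonged ray starts in the
closed support of `q`, at distance `2t|ξ| - T` from `z`. For a non-empty story `z` is on an
obstacle, so this distance is at least `δ₀`, and the Hessian bound is uniform. -/

theorem boundary_subset_carrier : Θ.boundary ⊆ Θ.carrier := fun _ hx => le_of_eq hx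

theorem gradient_ne_zero {p : Space} (hp : p ∈ Θ.boundary) : gradient Θ.defFun p ≠ 0 :=
  Θ.regular p hp

theorem norm_normal_of_ne {p : Space} (hp : gradient Θ.defFun p ≠ 0) : ‖Θ.normal p‖ = 1 := by
  rw [normal, norm_smul, norm_inv, norm_norm, inv_mul_cancel₀ (norm_ne_zero_iff.2 hp)]

theorem norm_normal {p : Space} (hp : p ∈ Θ.boundary) : ‖Θ.normal p‖ = 1 :=
  Θ.norm_normal_of_ne (Θ.gradient_ne_zero hp)

theorem inner_normal_normal {p : Space} (hp : p ∈ Θ.boundary) :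
    inner ℝ (Θ.normal p) (Θ.normal p) = 1 := by
  rw [real_inner_self_eq_norm_sq, Θ.norm_normal hp]; norm_num

theorem inner_normal (p h : Space) :
    inner ℝ (Θ.normal p) h = ‖gradient Θ.defFun p‖⁻¹ * inner ℝ (gradient Θ.defFun p) h := by
  rw [normal, inner_smul_left]; simp

theorem inner_normal_eq_zero {p : Space} (hp : p ∈ Θ.boundary) (h : Space) :
    inner ℝ (Θ.normal p) h = 0 ↔ inner ℝ (gradient Θ.defFun p) h = 0 := by
  rw [inner_normal, mul_eq_zero, or_iff_right]
  exact inv_ne_zero (norm_ne_zero_iff.2 (Θ.gradient_ne_zero hp))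

theorem differentiable : Differentiable ℝ Θ.defFun := Θ.smooth.differentiable (by simp)

theorem fderiv_eq_inner (p h : Space) :
    fderiv ℝ Θ.defFun p h = inner ℝ (gradient Θ.defFun p) h := by
  rw [gradient, InnerProductSpace.toDual_symm_apply]

theorem inner_normal_sub_nonpos {p x : Space} (hp : p ∈ Θ.boundary) (hx : x ∈ Θ.carrier) :
    inner ℝ (Θ.normal p) (x - p) ≤ 0 := by
  have hmax : IsLocalMaxOn Θ.defFun Θ.carrier p := by
    filter_upwards [self_mem_nhdsWithin] with z hz
    rw [show Θ.defFun p = 0 from hp]; exact hz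
  have h := hmax.hasFDerivWithinAt_nonpos (Θ.differentiable p).hasFDerivAt.hasFDerivWithinAt
    (sub_mem_posTangentConeAt_of_segment_subset
      (Θ.convex.segment_subset (Θ.boundary_subset_carrier hp) hx))
  rw [fderiv_eq_inner] at h
  rw [inner_normal]
  exact mul_nonpos_of_nonneg_of_nonpos (by positivity) h

/-- Otherwise the boundary would contain a segment in the tangent plane at `p`, and the second
derivative of `defFun` along it would vanish, against the curvature bound. -/
theorem eq_of_inner_normal_sub_eq_zero {p x : Space} (hp : p ∈ Θ.boundary) (hx : x ∈ Θ.boundary)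
    (h : inner ℝ (Θ.normal p) (x - p) = 0) : x = p := by
  set e := x - p with he
  -- A point of the segment inside the obstacle could be moved slightly along the normal without
  -- leaving it, thus crossing the supporting plane at `p`.
  have hseg : ∀ ε ∈ Set.Ioo (0 : ℝ) 1, Θ.defFun (p + ε • e) = 0 := by
    intro ε hε
    have hm : Θ.defFun (p + ε • e) ≤ 0 := by
      have := Θ.convex.add_smul_sub_mem (Θ.boundary_subset_carrier hp)
        (Θ.boundary_subset_carrier hx) ⟨hε.1.le, hε.2.le⟩
      exact this
    refine le_antisymm hm (not_lt.1 fun hlt => ?_)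
    have hc : ContinuousAt (fun s : ℝ => Θ.defFun (p + ε • e + s • Θ.normal p)) 0 := by
      have := Θ.smooth.continuous
      fun_prop
    have hev : ∀ᶠ s in 𝓝[>] (0 : ℝ), Θ.defFun (p + ε • e + s • Θ.normal p) < 0 :=
      (hc.eventually_lt continuousAt_const (by simpa using hlt)).filter_mono nhdsWithin_le_nhds
    obtain ⟨s, hs, hs0⟩ := (hev.and self_mem_nhdsWithin).exists
    have h1 := Θ.inner_normal_sub_nonpos hp (x := p + ε • e + s • Θ.normal p) hs.le
    have h2 : p + ε • e + s • Θ.normal p - p = ε • e + s • Θ.normal p := by abel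
    rw [h2, inner_add_right, inner_smul_right, inner_smul_right, h, Θ.inner_normal_normal hp] at h1
    have : (0 : ℝ) < s := hs0
    linarith
  have hline : ∀ ε : ℝ, HasDerivAt (fun s : ℝ => p + s • e) e ε := fun ε => by
    simpa using ((hasDerivAt_id ε).smul_const e).const_add p
  have hk : ∀ ε ∈ Set.Ioo (0 : ℝ) 1, fderiv ℝ Θ.defFun (p + ε • e) e = 0 := by
    intro ε hε
    have h1 : HasDerivAt (fun s : ℝ => Θ.defFun (p + s • e)) (fderiv ℝ Θ.defFun (p + ε • e) e) ε :=
      (Θ.differentiable _).hasFDerivAt.comp_hasDerivAt ε (hline ε)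
    have h2 : HasDerivAt (fun s : ℝ => Θ.defFun (p + s • e)) 0 ε :=
      (hasDerivAt_const ε (0 : ℝ)).congr_of_eventuallyEq
        (by filter_upwards [isOpen_Ioo.mem_nhds hε] with s hs using hseg s hs)
    exact h1.unique h2
  have hd : Differentiable ℝ fun z => fderiv ℝ Θ.defFun z e :=
    ((Θ.smooth.fderiv_right (m := ∞) (by simp)).clm_apply contDiff_const).differentiable (by simp)
  have h3 : HasDerivAt (fun s : ℝ => fderiv ℝ Θ.defFun (p + s • e) e)
      (fderiv ℝ (fun z => fderiv ℝ Θ.defFun z e) p e) 0 := by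
    have := (hd (p + (0 : ℝ) • e)).hasFDerivAt.comp_hasDerivAt 0 (hline 0)
    rw [zero_smul, add_zero] at this
    exact this
  have htan : inner ℝ (gradient Θ.defFun p) e = 0 := (Θ.inner_normal_eq_zero hp e).1 h
  -- The boundary is known to contain the segment only on one side of `p`, hence a one-sided
  -- derivative at zero.
  have h4 : HasDerivWithinAt (fun s : ℝ => fderiv ℝ Θ.defFun (p + s • e) e) 0 (Set.Ioi 0) 0 := by
    refine (hasDerivWithinAt_const (0 : ℝ) _ (0 : ℝ)).congr_of_eventuallyEq ?_ ?_
    · filter_upwards [Ioo_mem_nhdsGT (zero_lt_one' ℝ)] with s hs using hk s hs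
    · simp [fderiv_eq_inner, htan]
  have h5 := (uniqueDiffWithinAt_Ioi (0 : ℝ)).eq_deriv _ h3.hasDerivWithinAt h4
  obtain ⟨κ, hκ, hcurv⟩ := Θ.curvature
  have h6 := hcurv p hp e htan
  rw [h5, zero_div] at h6
  have h7 : ‖e‖ ^ 2 ≤ 0 := by nlinarith
  have h8 : e = 0 := by
    rw [← norm_eq_zero]; exact pow_eq_zero_iff (two_ne_zero) |>.1 (le_antisymm h7 (by positivity))
  rwa [he, sub_eq_zero] at h8

theorem contDiff_gradient : ContDiff ℝ ∞ (gradient Θ.defFun) :=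
  (InnerProductSpace.toDual ℝ Space).symm.contDiff.comp (Θ.smooth.fderiv_right (m := ∞) (by simp))

theorem contDiffAt_normal {p : Space} (hp : p ∈ Θ.boundary) : ContDiffAt ℝ ∞ Θ.normal p := by
  have h := Θ.contDiff_gradient.contDiffAt (x := p)
  exact ((h.norm ℝ (Θ.gradient_ne_zero hp)).inv
    (norm_ne_zero_iff.2 (Θ.gradient_ne_zero hp))).smul h

/-- Differentiating the normalizing factor contributes only a multiple of the gradient, which is
orthogonal to tangent vectors. -/
theorem exists_fderiv_normal_ge : ∃ κ : ℝ, 0 < κ ∧ ∀ p ∈ Θ.boundary, ∀ e : Space,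
    inner ℝ (Θ.normal p) e = 0 → κ * ‖e‖ ^ 2 ≤ inner ℝ (fderiv ℝ Θ.normal p e) e := by
  obtain ⟨κ, hκ, hcurv⟩ := Θ.curvature
  refine ⟨κ, hκ, fun p hp e he => ?_⟩
  have htan := (Θ.inner_normal_eq_zero hp e).1 he
  refine (hcurv p hp e htan).trans_eq ?_
  have hg := (Θ.contDiff_gradient.differentiable (by simp) p).hasFDerivAt
  have hn : DifferentiableAt ℝ (fun x => ‖gradient Θ.defFun x‖⁻¹) p :=
    (((Θ.contDiff_gradient.contDiffAt (x := p)).norm ℝ (Θ.gradient_ne_zero hp)).inv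
      (norm_ne_zero_iff.2 (Θ.gradient_ne_zero hp))).differentiableAt (by simp)
  have h1 : fderiv ℝ Θ.normal p = _ := (hn.hasFDerivAt.smul hg).fderiv
  have h2 : fderiv ℝ (fun z => fderiv ℝ Θ.defFun z e) p e
      = inner ℝ (fderiv ℝ (gradient Θ.defFun) p e) e := by
    have : (fun z => fderiv ℝ Θ.defFun z e) = fun z => inner ℝ (gradient Θ.defFun z) e :=
      funext fun z => Θ.fderiv_eq_inner z e
    rw [this, fderiv_inner_apply ℝ hg.differentiableAt (differentiableAt_const _)]
    simp
  rw [h1, h2]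
  simp [inner_add_left, inner_smul_left, htan, div_eq_inv_mul]

theorem bounce_smul (p v : Space) (r : ℝ) : Θ.bounce p (r • v) = r • Θ.bounce p v := by
  simp only [bounce, inner_smul_left, smul_sub, smul_smul]; simp; ring_nf

theorem inner_bounce_bounce_of_ne {p : Space} (hp : gradient Θ.defFun p ≠ 0) (v w : Space) :
    inner ℝ (Θ.bounce p v) (Θ.bounce p w) = inner ℝ v w := by
  have : inner ℝ (Θ.normal p) (Θ.normal p) = 1 := by
    rw [real_inner_self_eq_norm_sq, Θ.norm_normal_of_ne hp]; norm_num
  simp only [bounce, inner_sub_left, inner_sub_right, inner_smul_left, inner_smul_right, this,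
    real_inner_comm (Θ.normal p)]
  simp; ring

theorem inner_bounce_bounce {p : Space} (hp : p ∈ Θ.boundary) (v w : Space) :
    inner ℝ (Θ.bounce p v) (Θ.bounce p w) = inner ℝ v w :=
  Θ.inner_bounce_bounce_of_ne (Θ.gradient_ne_zero hp) v w

theorem norm_bounce {p : Space} (hp : p ∈ Θ.boundary) (v : Space) : ‖Θ.bounce p v‖ = ‖v‖ := by
  rw [← sq_eq_sq₀ (norm_nonneg _) (norm_nonneg _), ← real_inner_self_eq_norm_sq,
    ← real_inner_self_eq_norm_sq, Θ.inner_bounce_bounce hp]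

theorem bounce_bounce {p : Space} (hp : p ∈ Θ.boundary) (v : Space) :
    Θ.bounce p (Θ.bounce p v) = v := by
  have := Θ.inner_normal_normal hp
  simp only [bounce, inner_sub_left, inner_smul_left, this]
  simp only [sub_sub, ← add_smul]
  simp
  left; ring

theorem inner_bounce (p v e : Space) : inner ℝ (Θ.bounce p v) e
    = inner ℝ v e - 2 * inner ℝ v (Θ.normal p) * inner ℝ (Θ.normal p) e := by
  simp only [bounce, inner_sub_left, inner_smul_left]; simp

end Obstacle

end TwoObstacles

/-! ### Rays, the Fermat principle and uniqueness -/

namespace TwoObstacles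

open Filter Topology

/-- The ray which starts at `z` with unit velocity `v` and is reflected successively on the
obstacles in the list, with angles of incidence quantified by `δ`, is at `x` after the length `T`,
after all reflections and with the velocity `V`. -/
def Ray (Θ : Fin 2 → Obstacle) (δ : ℝ) : List (Fin 2) → Space → Space → ℝ → Space → Space → Prop
  | [], z, v, T, x, V => 0 ≤ T ∧ x = z + T • v ∧ V = v
  | j :: J, z, v, T, x, V => ∃ s : ℝ, 0 ≤ s ∧ z + s • v ∈ (Θ j).boundary ∧
      δ < -inner ℝ ((Θ j).normal (z + s • v)) v ∧
      Ray Θ δ J (z + s • v) ((Θ j).bounce (z + s • v) v) (T - s) x V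

/-- A ray which starts at its first point of reflection, or has length zero if there is none. -/
def Path (Θ : Fin 2 → Obstacle) (δ : ℝ) : List (Fin 2) → Space → Space → ℝ → Space → Space → Prop
  | [], z, v, T, x, V => T = 0 ∧ x = z ∧ V = v
  | j :: J, z, v, T, x, V => z ∈ (Θ j).boundary ∧ δ < -inner ℝ ((Θ j).normal z) v ∧
      Ray Θ δ J z ((Θ j).bounce z v) T x V

variable {Θ : Fin 2 → Obstacle} {δ : ℝ} {J : List (Fin 2)} {z z' v v' x x' V V' : Space} {T T' : ℝ}

theorem Path.ray (h : Path Θ δ J z v T x V) : Ray Θ δ J z v T x V := by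
  cases J with
  | nil => obtain ⟨rfl, rfl, rfl⟩ := h; exact ⟨le_rfl, by simp, rfl⟩
  | cons j J => exact ⟨0, le_rfl, by simpa using h.1, by simpa using h.2.1, by simpa using h.2.2⟩

theorem Ray.mono {δ' : ℝ} (hδ : δ' ≤ δ) (h : Ray Θ δ J z v T x V) : Ray Θ δ' J z v T x V := by
  induction J generalizing z v T with
  | nil => exact h
  | cons j J ih =>
    obtain ⟨s, h0, h1, h2, h3⟩ := h
    exact ⟨s, h0, h1, hδ.trans_lt h2, ih h3⟩

theorem Path.mono {δ' : ℝ} (hδ : δ' ≤ δ) (h : Path Θ δ J z v T x V) : Path Θ δ' J z v T x V := by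
  cases J with
  | nil => exact h
  | cons j J => exact ⟨h.1, hδ.trans_lt h.2.1, h.2.2.mono hδ⟩

/-- Every ray contains a path. -/
theorem Ray.exists_path (h : Ray Θ δ J z v T x V) :
    ∃ z' T', T' ≤ T ∧ z' + T' • v = z + T • v ∧ Path Θ δ J z' v T' x V := by
  cases J with
  | nil =>
    obtain ⟨h0, rfl, rfl⟩ := h
    exact ⟨_, 0, h0, by simp, rfl, rfl, rfl⟩
  | cons j J =>
    obtain ⟨s, h0, h1, h2, h3⟩ := h
    exact ⟨_, T - s, by linarith, by module, h1, h2, h3⟩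

theorem ray_snoc_iff {j : Fin 2} : Ray Θ δ (J ++ [j]) z v T x V ↔ ∃ p W τ, 0 ≤ τ ∧
    Ray Θ δ J z v (T - τ) p W ∧ p ∈ (Θ j).boundary ∧ δ < -inner ℝ ((Θ j).normal p) W ∧
    V = (Θ j).bounce p W ∧ x = p + τ • V := by
  induction J generalizing z v T with
  | nil =>
    constructor
    · rintro ⟨s, h0, h1, h2, h3, h4, h5⟩
      exact ⟨_, _, T - s, h3, ⟨by simpa using h0, by simp, rfl⟩, h1, h2, h5, by rw [h4, h5]⟩
    · rintro ⟨p, W, τ, h0, ⟨h1, rfl, rfl⟩, h2, h3, h4, h5⟩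
      exact ⟨T - τ, h1, h2, h3, by simpa using h0, by rw [h5, h4]; simp, h4⟩
  | cons i J ih =>
    constructor
    · rintro ⟨s, h0, h1, h2, h3⟩
      obtain ⟨p, W, τ, k0, k1, k2⟩ := ih.1 h3
      exact ⟨p, W, τ, k0, ⟨s, h0, h1, h2, by rwa [sub_right_comm]⟩, k2⟩
    · rintro ⟨p, W, τ, k0, ⟨s, h0, h1, h2, h3⟩, k2⟩
      exact ⟨s, h0, h1, h2, ih.2 ⟨p, W, τ, k0, by rwa [sub_right_comm], k2⟩⟩

theorem path_snoc_iff {j : Fin 2} : Path Θ δ (J ++ [j]) z v T x V ↔ ∃ p W τ, 0 ≤ τ ∧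
    Path Θ δ J z v (T - τ) p W ∧ p ∈ (Θ j).boundary ∧ δ < -inner ℝ ((Θ j).normal p) W ∧
    V = (Θ j).bounce p W ∧ x = p + τ • V := by
  cases J with
  | nil =>
    constructor
    · rintro ⟨h1, h2, h3, h4, h5⟩
      exact ⟨_, _, T, h3, ⟨by simp, rfl, rfl⟩, h1, h2, h5, by rw [h4, h5]⟩
    · rintro ⟨p, W, τ, h0, ⟨h1, rfl, rfl⟩, h2, h3, h4, h5⟩
      obtain rfl : T = τ := by linarith
      exact ⟨h2, h3, h0, by rw [h5, h4], h4⟩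
  | cons i J =>
    constructor
    · rintro ⟨h1, h2, h3⟩
      obtain ⟨p, W, τ, k0, k1, k2⟩ := ray_snoc_iff.1 h3
      exact ⟨p, W, τ, k0, ⟨h1, h2, k1⟩, k2⟩
    · rintro ⟨p, W, τ, k0, ⟨h1, h2, h3⟩, k2⟩
      exact ⟨h1, h2, ray_snoc_iff.2 ⟨p, W, τ, k0, h3, k2⟩⟩

theorem Path.nonneg (h : Path Θ δ J z v T x V) : 0 ≤ T := by
  induction J using List.reverseRecOn generalizing T x V with
  | nil => exact h.1.ge
  | append_singleton J j ih =>
    obtain ⟨p, W, τ, k0, k1, -⟩ := path_snoc_iff.1 h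
    linarith [ih k1]

theorem Ray.norm_eq (h : Ray Θ δ J z v T x V) : ‖V‖ = ‖v‖ := by
  induction J generalizing z v T with
  | nil => rw [h.2.2]
  | cons j J ih =>
    obtain ⟨s, h0, h1, h2, h3⟩ := h
    rw [ih h3, (Θ j).norm_bounce h1]

/-- Reflections on a convex obstacle spread the rays. -/
theorem Obstacle.inner_bounce_sub_le (Θ : Obstacle) {p p' v : Space} (hp : p ∈ Θ.boundary)
    (hp' : p' ∈ Θ.boundary) (hv : 0 ≤ -inner ℝ (Θ.normal p) v) :
    inner ℝ (Θ.bounce p v) (p' - p) ≤ inner ℝ v (p' - p) := by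
  rw [Θ.inner_bounce, real_inner_comm (Θ.normal p) v]
  nlinarith [mul_nonneg hv (neg_nonneg.2
    (Θ.inner_normal_sub_nonpos hp (Θ.boundary_subset_carrier hp')))]

theorem Obstacle.eq_of_inner_bounce_sub_eq (Θ : Obstacle) {p p' v : Space} (hp : p ∈ Θ.boundary)
    (hp' : p' ∈ Θ.boundary) (hv : 0 < -inner ℝ (Θ.normal p) v)
    (h : inner ℝ v (p' - p) ≤ inner ℝ (Θ.bounce p v) (p' - p)) : p' = p := by
  refine Θ.eq_of_inner_normal_sub_eq_zero hp hp' (le_antisymm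
    (Θ.inner_normal_sub_nonpos hp (Θ.boundary_subset_carrier hp')) ?_)
  rw [Θ.inner_bounce, real_inner_comm (Θ.normal p) v] at h
  by_contra! hc
  nlinarith [mul_pos hv (neg_pos.2 hc)]

theorem inner_le_one (hv : ‖v‖ = 1) (hv' : ‖v'‖ = 1) : inner ℝ v v' ≤ 1 := by
  simpa [hv, hv'] using real_inner_le_norm v v'

/-- A Fermat principle for two rays with the same story. -/
theorem Ray.inner_sub_le (hδ : 0 ≤ δ) (h : Ray Θ δ J z v T x V) (h' : Ray Θ δ J z' v' T' x' V')
    (hv : ‖v‖ = 1) (hv' : ‖v'‖ = 1) :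
    inner ℝ V (x' - x) ≤ inner ℝ v (z' - z) + (T' - T) := by
  have hle : inner ℝ v v' ≤ 1 := inner_le_one hv hv'
  have hvv : inner ℝ v v = 1 := by rw [real_inner_self_eq_norm_sq, hv]; norm_num
  induction J generalizing z v T z' v' T' with
  | nil =>
    obtain ⟨h0, rfl, rfl⟩ := h
    obtain ⟨h0', rfl, rfl⟩ := h'
    simp only [inner_sub_right, inner_add_right, inner_smul_right, hvv]
    nlinarith
  | cons j J ih =>
    obtain ⟨s, h0, h1, h2, h3⟩ := h
    obtain ⟨s', h0', h1', h2', h3'⟩ := h'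
    have hb := (Θ j).norm_bounce h1 v
    have hb' := (Θ j).norm_bounce h1' v'
    have key := ih h3 h3' (hb.trans hv) (hb'.trans hv')
      (inner_le_one (hb.trans hv) (hb'.trans hv'))
      (by rw [(Θ j).inner_bounce_bounce h1, hvv])
    have h4 := (Θ j).inner_bounce_sub_le h1 h1' (hδ.trans h2.le)
    have h5 : inner ℝ v (z' + s' • v' - (z + s • v)) = inner ℝ v (z' - z) + s' * inner ℝ v v' - s := by
      simp only [inner_sub_right, inner_add_right, inner_smul_right, hvv]; ring
    nlinarith

/-- Rays with the same story spread out. -/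
theorem Ray.inner_sub_sub_le (hδ : 0 ≤ δ) (h : Ray Θ δ J z v T x V)
    (h' : Ray Θ δ J z' v' T' x' V') (hv : ‖v‖ = 1) (hv' : ‖v'‖ = 1) :
    inner ℝ (z' - z) (v' - v) ≤ inner ℝ (x' - x) (V' - V) := by
  have h1 := h.inner_sub_le hδ h' hv hv'
  have h2 := h'.inner_sub_le hδ h hv' hv
  rw [real_inner_comm] at h1 h2
  rw [real_inner_comm (z' - z)] at h1
  rw [real_inner_comm (z - z')] at h2
  rw [← neg_sub x', ← neg_sub z', inner_neg_left, inner_neg_left] at h2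
  rw [inner_sub_right, inner_sub_right]
  linarith

/-- The equality case of the Fermat principle for rays with a common endpoint: the losses in flight,
at the first reflection and on the remaining story are all nonnegative, so each of them vanishes. -/
theorem Ray.cons_eq {j : Fin 2} {s s' : ℝ} (hδ : 0 ≤ δ) (hv : ‖v‖ = 1) (hv' : ‖v'‖ = 1)
    (hs' : 0 ≤ s')
    (h1 : z + s • v ∈ (Θ j).boundary) (h2 : δ < -inner ℝ ((Θ j).normal (z + s • v)) v)
    (h3 : Ray Θ δ J (z + s • v) ((Θ j).bounce (z + s • v) v) (T - s) x V)
    (h1' : z' + s' • v' ∈ (Θ j).boundary)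
    (h3' : Ray Θ δ J (z' + s' • v') ((Θ j).bounce (z' + s' • v') v') (T' - s') x V')
    (hle : inner ℝ v (z' - z) + (T' - T) ≤ 0) :
    z' + s' • v' = z + s • v ∧ s' * (1 - inner ℝ v v') ≤ 0 ∧ T' - s' ≤ T - s := by
  have hb := (Θ j).norm_bounce h1 v
  have hb' := (Θ j).norm_bounce h1' v'
  have key := h3.inner_sub_le hδ h3' (hb.trans hv) (hb'.trans hv')
  have h4 := (Θ j).inner_bounce_sub_le h1 h1' (hδ.trans h2.le)
  have hvv : inner ℝ v v = 1 := by rw [real_inner_self_eq_norm_sq, hv]; norm_num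
  have hle' : inner ℝ v v' ≤ 1 := inner_le_one hv hv'
  have h5 : inner ℝ v (z' + s' • v' - (z + s • v)) = inner ℝ v (z' - z) + s' * inner ℝ v v' - s := by
    simp only [inner_sub_right, inner_add_right, inner_smul_right, hvv]; ring
  have h6 : 0 ≤ s' * (1 - inner ℝ v v') := mul_nonneg hs' (by linarith)
  simp only [sub_self, inner_zero_right] at key
  have h7 := (Θ j).eq_of_inner_bounce_sub_eq h1 h1' (hδ.trans_lt h2) (by nlinarith)
  rw [h7, sub_self, inner_zero_right] at h5
  rw [h7, sub_self, inner_zero_right] at key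
  exact ⟨h7, by nlinarith, by nlinarith⟩

theorem eq_of_one_le_inner (hv : ‖v‖ = 1) (hv' : ‖v'‖ = 1) (h : 1 ≤ inner ℝ v v') : v = v' := by
  refine (inner_eq_one_iff_of_norm_eq_one (𝕜 := ℝ) hv hv').1 (le_antisymm (inner_le_one hv hv') h)

/-- The ray with given initial direction through a point is unique. -/
theorem Ray.unique (hδ : 0 ≤ δ) (h : Ray Θ δ J z v T x V) (h' : Ray Θ δ J z' v T' x V')
    (hv : ‖v‖ = 1) : z + T • v = z' + T' • v ∧ V = V' := by
  have e1 := h.inner_sub_le hδ h' hv hv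
  have e2 := h'.inner_sub_le hδ h hv hv
  rw [← neg_sub z', inner_neg_right] at e2
  simp only [sub_self, inner_zero_right] at e1 e2
  induction J generalizing z v T z' T' with
  | nil => exact ⟨h.2.1.symm.trans h'.2.1, h.2.2.trans h'.2.2.symm⟩
  | cons j J ih =>
    obtain ⟨s, h0, h1, h2, h3⟩ := h
    obtain ⟨s', h0', h1', h2', h3'⟩ := h'
    obtain ⟨k1, -, k2⟩ := Ray.cons_eq hδ hv hv h0' h1 h2 h3 h1' h3' (by linarith)
    obtain ⟨-, -, k3⟩ := Ray.cons_eq hδ hv hv h0 h1' h2' h3' h1 h3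
      (by rw [← neg_sub z', inner_neg_right]; linarith)
    have k4 : T' - s' = T - s := le_antisymm k2 k3
    rw [k1, k4] at h3'
    refine ⟨?_, (ih h3 h3' (((Θ j).norm_bounce h1 v).trans hv) (by simp) (by simp)).2⟩
    have : z + T • v = (z + s • v) + (T - s) • v := by module
    rw [this, ← k1, ← k4]; module

/-- The ray between two points is unique. -/
theorem Ray.unique_of_start (hδ : 0 ≤ δ) (h : Ray Θ δ J z v T x V) (h' : Ray Θ δ J z v' T' x V')
    (hv : ‖v‖ = 1) (hv' : ‖v'‖ = 1) (hT : 0 < T) : T = T' ∧ v = v' := by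
  have e1 := h.inner_sub_le hδ h' hv hv'
  have e2 := h'.inner_sub_le hδ h hv' hv
  simp only [sub_self, inner_zero_right] at e1 e2
  obtain rfl : T = T' := by linarith
  refine ⟨rfl, ?_⟩
  clear e1 e2
  induction J generalizing z v T v' with
  | nil =>
    have := h.2.1.symm.trans h'.2.1
    exact smul_right_injective _ hT.ne' (add_left_cancel this)
  | cons j J ih =>
    obtain ⟨s, h0, h1, h2, h3⟩ := h
    obtain ⟨s', h0', h1', h2', h3'⟩ := h'
    obtain ⟨k1, k1', k2⟩ := Ray.cons_eq hδ hv hv' h0' h1 h2 h3 h1' h3' (by simp)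
    obtain ⟨-, k3', k3⟩ := Ray.cons_eq hδ hv' hv h0 h1' h2' h3' h1 h3 (by simp)
    obtain rfl : s = s' := by linarith
    -- A first flight of length zero does not determine the direction. In that case the outgoing
    -- directions are compared instead, reflection being an involution.
    rcases h0.eq_or_lt with rfl | hs
    · rw [k1] at h3'
      have := ih h3 (((Θ j).norm_bounce h1 v).trans hv)
        (((Θ j).norm_bounce h1 v').trans hv') (by simpa using hT) h3'
      rw [← (Θ j).bounce_bounce h1 v, this, (Θ j).bounce_bounce h1]
    · exact eq_of_one_le_inner hv hv' (by nlinarith)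

theorem Path.unique (hδ : 0 ≤ δ) (h : Path Θ δ J z v T x V) (h' : Path Θ δ J z' v T' x V')
    (hv : ‖v‖ = 1) : z = z' ∧ T = T' ∧ V = V' := by
  obtain ⟨h1, h2⟩ := h.ray.unique hδ h'.ray hv
  suffices z = z' by
    subst this
    have hv0 : v ≠ 0 := fun h => by simp [h] at hv
    exact ⟨rfl, smul_left_injective _ hv0 (add_left_cancel h1), h2⟩
  cases J with
  | nil => exact h.2.1.symm.trans h'.2.1
  | cons j J =>
    have e1 := h.ray.inner_sub_le hδ h'.ray hv hv
    have e2 := h'.ray.inner_sub_le hδ h.ray hv hv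
    rw [← neg_sub z', inner_neg_right] at e2
    simp only [sub_self, inner_zero_right] at e1 e2
    have := Ray.cons_eq (s := 0) (s' := 0) hδ hv hv le_rfl (by simpa using h.1)
      (by simpa using h.2.1) (by simpa using h.2.2) (by simpa using h'.1) (by simpa using h'.2.2)
      (by linarith)
    simpa using this.1.symm

/-- Passage from time at speed `r` to arc length; transversality is incidence with `δ = 0`. -/
theorem rayReaches_iff {T : ℝ} {r : ℝ} (hr : 0 < r) :
    RayReaches Θ J z (r • v) T x ↔ ∃ V, Ray Θ 0 J z v (r * T) x V := by
  induction J generalizing z v T with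
  | nil =>
    simp only [RayReaches, Ray, exists_and_left, exists_eq, and_true, smul_smul, mul_comm r T]
    rw [mul_nonneg_iff_of_pos_right hr]
  | cons j J ih =>
    simp only [RayReaches, Ray]
    constructor
    · rintro ⟨s, h0, h1, h2, h3⟩
      rw [smul_smul, mul_comm] at h1 h2 h3
      rw [(Θ j).bounce_smul, ih, mul_sub] at h3
      obtain ⟨V, hV⟩ := h3
      rw [inner_smul_left, real_inner_comm] at h2
      refine ⟨V, r * s, by positivity, h1, ?_, hV⟩
      simp only [conj_trivial] at h2
      nlinarith
    · rintro ⟨V, s, h0, h1, h2, h3⟩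
      have e : (s / r) • r • v = s • v := by rw [smul_smul, div_mul_cancel₀ _ hr.ne']
      refine ⟨s / r, by positivity, by rwa [e], ?_, ?_⟩
      · rw [e, inner_smul_left, real_inner_comm]; simp only [conj_trivial]
        nlinarith
      · rw [e, (Θ j).bounce_smul, ih, mul_sub, mul_div_cancel₀ _ hr.ne']
        exact ⟨V, h3⟩

end TwoObstacles

/-! ### Infinitesimal reflection and the inverse function theorem -/

namespace TwoObstacles

open Filter Topology

section Calculus

variable {E F : Type*} [NormedAddCommGroup E] [NormedAddCommGroup F] [InnerProductSpace ℝ F]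

/-- Division by `s ^ 2` turns quadratic inequalities for increments into inequalities for
derivatives. The factor `k` may vary with `s`, which is needed for the length of the path. -/
theorem inner_deriv_le {f g : ℝ → F} {f' g' : F} {k : ℝ → ℝ} (hf : HasDerivAt f f' 0)
    (hg : HasDerivAt g g' 0) (hk : ContinuousAt k 0)
    (h : ∀ᶠ s in 𝓝 (0 : ℝ), inner ℝ (f s - f 0) (g s - g 0) ≤ k s * ‖g s - g 0‖ ^ 2) :
    inner ℝ f' g' ≤ k 0 * ‖g'‖ ^ 2 := by
  have h1 := hasDerivAt_iff_tendsto_slope.1 hf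
  have h2 := hasDerivAt_iff_tendsto_slope.1 hg
  refine le_of_tendsto_of_tendsto (h1.inner h2)
    ((hk.tendsto.mono_left nhdsWithin_le_nhds).mul (h2.norm.pow 2)) ?_
  filter_upwards [h.filter_mono nhdsWithin_le_nhds] with s hs
  simp only [slope_def_module, sub_zero, inner_smul_left, inner_smul_right, norm_smul, mul_pow]
  simp only [conj_trivial, Real.norm_eq_abs, sq_abs]
  nlinarith [mul_le_mul_of_nonneg_left hs (sq_nonneg s⁻¹)]

theorem exists_local_inverse [NormedSpace ℝ E] [FiniteDimensional ℝ E] {f : E → E} {a : E}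
    (hf : ContDiffAt ℝ ∞ f a) (hinj : ∀ e, fderiv ℝ f a e = 0 → e = 0) :
    ∃ g : E → E, ContDiffAt ℝ ∞ g (f a) ∧ g (f a) = a ∧ ∀ᶠ b in 𝓝 (f a), f (g b) = b := by
  have : CompleteSpace E := FiniteDimensional.complete ℝ E
  have hi : Function.Injective (fderiv ℝ f a : E →ₗ[ℝ] E) :=
    (injective_iff_map_eq_zero _).2 hinj
  set e : E ≃L[ℝ] E := (LinearEquiv.ofInjectiveEndo _ hi).toContinuousLinearEquiv with he
  have hd : HasFDerivAt f (e : E →L[ℝ] E) a := by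
    have h1 : (e : E →L[ℝ] E) = fderiv ℝ f a := by ext x; rfl
    rw [h1]
    exact (hf.differentiableAt (by simp)).hasFDerivAt
  have hn : (∞ : WithTop ℕ∞) ≠ 0 := by simp
  exact ⟨hf.localInverse hd hn, hf.to_localInverse hd hn, hf.localInverse_apply_image hd hn,
    (hf.hasStrictFDerivAt' hd hn).eventually_right_inverse⟩

end Calculus

theorem hasDerivAt_add_smul (p e : Space) (ε : ℝ) :
    HasDerivAt (fun s : ℝ => p + s • e) e ε := by
  simpa using ((hasDerivAt_id ε).smul_const e).const_add p

/-- For tangential displacements the derivative of the coefficient of the normal is invisible; what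
remains is the curvature, weighted by the angle of incidence. -/
theorem Obstacle.inner_deriv_bounce (Θ : Obstacle) {p e W' D : Space} {W : ℝ → Space}
    (hp : p ∈ Θ.boundary) (he : inner ℝ (Θ.normal p) e = 0) (hW : HasDerivAt W W' 0)
    (hD : HasDerivAt (fun s : ℝ => Θ.bounce (p + s • e) (W s)) D 0) :
    inner ℝ e D = inner ℝ e W'
      + 2 * -inner ℝ (Θ.normal p) (W 0) * inner ℝ (fderiv ℝ Θ.normal p e) e := by
  have hn : HasDerivAt (fun s : ℝ => Θ.normal (p + s • e)) (fderiv ℝ Θ.normal p e) 0 := by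
    have h1 : HasFDerivAt Θ.normal (fderiv ℝ Θ.normal p) (p + (0 : ℝ) • e) := by
      simpa using ((Θ.contDiffAt_normal hp).differentiableAt (by simp)).hasFDerivAt
    exact h1.comp_hasDerivAt 0 (hasDerivAt_add_smul p e 0)
  have h2 := hW.sub (((hW.inner ℝ hn).const_mul 2).smul hn)
  rw [hD.unique h2]
  have he' : inner ℝ e (Θ.normal p) = 0 := by rw [real_inner_comm, he]
  simp only [inner_sub_right, inner_add_right, inner_smul_right, zero_smul, add_zero, he',
    real_inner_comm (fderiv ℝ Θ.normal p e) e, real_inner_comm (W 0) (Θ.normal p)]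
  ring

/-- The direction of a non-zero vector. -/
noncomputable def unit (ξ : Space) : Space := ‖ξ‖⁻¹ • ξ

theorem norm_unit {ξ : Space} (h : ξ ≠ 0) : ‖unit ξ‖ = 1 := by
  rw [unit, norm_smul, norm_inv, norm_norm, inv_mul_cancel₀ (norm_ne_zero_iff.2 h)]

theorem norm_smul_unit {ξ : Space} (h : ξ ≠ 0) : ‖ξ‖ • unit ξ = ξ := by
  rw [unit, smul_smul, mul_inv_cancel₀ (norm_ne_zero_iff.2 h), one_smul]

theorem contDiffAt_unit {ξ : Space} (h : ξ ≠ 0) : ContDiffAt ℝ ∞ unit ξ :=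
  ((contDiffAt_norm ℝ h).inv (norm_ne_zero_iff.2 h)).smul contDiffAt_id

/-- Near `(x, ξ)` the paths with direction `ξ` and endpoint `x` depend smoothly on `(x, ξ)`. -/
structure SmoothPath (Θ : Fin 2 → Obstacle) (δ : ℝ) (J : List (Fin 2)) (a : Space × Space)
    (Z : Space × Space → Space) (T : Space × Space → ℝ) (V : Space × Space → Space) : Prop where
  start : ContDiffAt ℝ ∞ Z a
  length : ContDiffAt ℝ ∞ T a
  dir : ContDiffAt ℝ ∞ V a
  path : ∀ᶠ b in 𝓝 a, Path Θ δ J (Z b) (unit b.2) (T b) b.1 (V b)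

variable {Θ : Fin 2 → Obstacle} {δ : ℝ} {J : List (Fin 2)} {j : Fin 2}

section Reflection

variable (Θ₀ : Obstacle) (V : Space × Space → Space)

/-- The map whose local inverse finds the last point of reflection of a ray. -/
noncomputable def flowMap (a : Space × ℝ × Space) : Space × ℝ × Space :=
  (a.1 + a.2.1 • Θ₀.bounce a.1 (V (a.1, a.2.2)), Θ₀.defFun a.1, a.2.2)

variable {Θ₀ V} {p ξ : Space} {τ : ℝ}

theorem contDiffAt_bounce (hp : p ∈ Θ₀.boundary) (hV : ContDiffAt ℝ ∞ V (p, ξ)) :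
    ContDiffAt ℝ ∞ (fun b : Space × Space => Θ₀.bounce b.1 (V b)) (p, ξ) := by
  have hn : ContDiffAt ℝ ∞ (fun b : Space × Space => Θ₀.normal b.1) (p, ξ) :=
    ContDiffAt.comp (g := Θ₀.normal) (p, ξ) (Θ₀.contDiffAt_normal hp) contDiffAt_fst
  exact hV.sub ((contDiffAt_const.mul (hV.inner ℝ hn)).smul hn)

theorem contDiffAt_flowMap (hp : p ∈ Θ₀.boundary) (hV : ContDiffAt ℝ ∞ V (p, ξ)) :
    ContDiffAt ℝ ∞ (flowMap Θ₀ V) (p, τ, ξ) := by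
  have h1 : ContDiffAt ℝ ∞ (fun a : Space × ℝ × Space => (a.1, a.2.2)) (p, τ, ξ) := by fun_prop
  have h2 : ContDiffAt ℝ ∞ (fun a : Space × ℝ × Space => Θ₀.bounce a.1 (V (a.1, a.2.2)))
      (p, τ, ξ) :=
    ContDiffAt.comp (g := fun b : Space × Space => Θ₀.bounce b.1 (V b)) (p, τ, ξ)
      (contDiffAt_bounce hp hV) h1
  have h3 : ContDiffAt ℝ ∞ (fun a : Space × ℝ × Space => a.2.1) (p, τ, ξ) := by fun_prop
  have h4 : ContDiffAt ℝ ∞ (fun a : Space × ℝ × Space => Θ₀.defFun a.1) (p, τ, ξ) :=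
    Θ₀.smooth.contDiffAt.comp (p, τ, ξ) contDiffAt_fst
  exact (contDiffAt_fst.add (h3.smul h2)).prodMk (h4.prodMk (by fun_prop))

/-- Let `h` be the boundary displacement in a kernel vector and `D` the resulting variation of the
reflected direction. Pairing `h + τ D + σ Ξ = 0` with `D`, which is orthogonal to the unit vector
`Ξ`, gives `⟨h, D⟩ + τ |D|² = 0`. The incoming monotonicity and the positive curvature make `⟨h, D⟩`
positive unless `h = 0`. -/
theorem flowMap_injective (hp : p ∈ Θ₀.boundary) (hV : ContDiffAt ℝ ∞ V (p, ξ)) (hτ : 0 ≤ τ)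
    (hin : inner ℝ (Θ₀.normal p) (V (p, ξ)) < 0) (hnorm : ∀ᶠ b in 𝓝 (p, ξ), ‖V b‖ = 1)
    (hmono : ∀ᶠ b in 𝓝 (p, ξ), b.2 = ξ → 0 ≤ inner ℝ (b.1 - p) (V b - V (p, ξ)))
    (e : Space × ℝ × Space) (he : fderiv ℝ (flowMap Θ₀ V) (p, τ, ξ) e = 0) : e = 0 := by
  obtain ⟨h, σ, η⟩ := e
  set Ξ : Space × Space → Space := fun b => Θ₀.bounce b.1 (V b) with hΞ
  have dΞ := ((contDiffAt_bounce hp hV).differentiableAt (by simp)).hasFDerivAt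
  have hline : HasDerivAt (fun s : ℝ => ((p, τ, ξ) : Space × ℝ × Space) + s • (h, σ, η))
      (h, σ, η) 0 := by
    simpa using ((hasDerivAt_id (0 : ℝ)).smul_const (h, σ, η)).const_add (p, τ, ξ)
  have hF : HasDerivAt (fun s : ℝ => flowMap Θ₀ V ((p, τ, ξ) + s • (h, σ, η))) 0 0 := by
    have h1 : HasFDerivAt (flowMap Θ₀ V) (fderiv ℝ (flowMap Θ₀ V) (p, τ, ξ))
        ((p, τ, ξ) + (0 : ℝ) • (h, σ, η)) := by
      rw [zero_smul, add_zero]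
      exact ((contDiffAt_flowMap hp hV).differentiableAt (by simp)).hasFDerivAt
    have h2 := h1.comp_hasDerivAt 0 hline
    rwa [he] at h2
  have hF1 : HasDerivAt (fun s : ℝ => (flowMap Θ₀ V ((p, τ, ξ) + s • (h, σ, η))).1) 0 0 :=
    ((ContinuousLinearMap.fst ℝ Space (ℝ × Space)).hasFDerivAt.comp_hasDerivAt 0 hF).congr_deriv
      (by simp)
  have hF2 : HasDerivAt (fun s : ℝ => Θ₀.defFun (p + s • h)) 0 0 :=
    ((ContinuousLinearMap.fst ℝ ℝ Space).hasFDerivAt.comp_hasDerivAt 0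
      ((ContinuousLinearMap.snd ℝ Space (ℝ × Space)).hasFDerivAt.comp_hasDerivAt 0 hF)).congr_deriv
      (by simp)
  have hF3 : HasDerivAt (fun s : ℝ => ξ + s • η) 0 0 :=
    ((ContinuousLinearMap.snd ℝ ℝ Space).hasFDerivAt.comp_hasDerivAt 0
      ((ContinuousLinearMap.snd ℝ Space (ℝ × Space)).hasFDerivAt.comp_hasDerivAt 0 hF)).congr_deriv
      (by simp)
  have hη : η = 0 := (hasDerivAt_add_smul ξ η 0).unique hF3
  subst hη
  -- The second component of the map keeps the displacement tangent to the boundary.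
  have hg : inner ℝ (Θ₀.normal p) h = 0 := by
    rw [Θ₀.inner_normal_eq_zero hp, ← Θ₀.fderiv_eq_inner]
    have h1 : HasFDerivAt Θ₀.defFun (fderiv ℝ Θ₀.defFun p) (p + (0 : ℝ) • h) := by
      rw [zero_smul, add_zero]; exact (Θ₀.differentiable p).hasFDerivAt
    exact (h1.comp_hasDerivAt 0 (hasDerivAt_add_smul p h 0)).unique hF2
  have hc : HasDerivAt (fun s : ℝ => ((p + s • h, ξ) : Space × Space)) (h, 0) 0 :=
    (hasDerivAt_add_smul p h 0).prodMk (hasDerivAt_const 0 ξ)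
  have hc0 : (p + (0 : ℝ) • h, ξ) = (p, ξ) := by simp
  set D : Space := fderiv ℝ Ξ (p, ξ) (h, 0) with hD
  have hΞc : HasDerivAt (fun s : ℝ => Ξ (p + s • h, ξ)) D 0 := by
    rw [← hc0] at dΞ
    have := dΞ.comp_hasDerivAt 0 hc
    rwa [hc0] at this
  have hVc : HasDerivAt (fun s : ℝ => V (p + s • h, ξ)) (fderiv ℝ V (p, ξ) (h, 0)) 0 := by
    have h1 := (hV.differentiableAt (by simp)).hasFDerivAt
    rw [← hc0] at h1
    have := h1.comp_hasDerivAt 0 hc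
    rwa [hc0] at this
  have htend : Tendsto (fun s : ℝ => ((p + s • h, ξ) : Space × Space)) (𝓝 0) (𝓝 (p, ξ)) := by
    have := hc.continuousAt.tendsto
    rwa [hc0] at this
  have hmonoV : 0 ≤ inner ℝ h (fderiv ℝ V (p, ξ) (h, 0)) := by
    have h1 := inner_deriv_le (k := fun _ => 0) hVc.neg (hasDerivAt_add_smul p h 0)
      continuousAt_const (by
        filter_upwards [htend.eventually hmono] with s hs
        have := hs rfl
        simp only [zero_smul, add_zero, zero_mul, Pi.neg_apply]
        rw [real_inner_comm] at this
        rw [show -V (p + s • h, ξ) - -V (p, ξ) = -(V (p + s • h, ξ) - V (p, ξ)) by abel,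
          inner_neg_left]
        linarith)
    rw [inner_neg_left, real_inner_comm, zero_mul] at h1
    linarith
  have hflow : h + (τ • D + σ • Ξ (p, ξ)) = 0 := by
    have h1 : HasDerivAt (fun s : ℝ => τ + s * σ) σ 0 := by
      simpa using ((hasDerivAt_id (0 : ℝ)).mul_const σ).const_add τ
    have h2 := (hasDerivAt_add_smul p h 0).add (h1.smul hΞc)
    have h4 := h2.unique (hF1.congr_of_eventuallyEq (Eventually.of_forall fun s => by
      simp [flowMap, hΞ]))
    simpa using h4
  have hunit : inner ℝ (Ξ (p, ξ)) D = 0 := by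
    have hev : ∀ᶠ b : Space × Space in 𝓝 (p, ξ), inner ℝ (Ξ b) (Ξ b) = 1 := by
      have hne : ∀ᶠ b : Space × Space in 𝓝 (p, ξ), gradient Θ₀.defFun b.1 ≠ 0 :=
        (Θ₀.contDiff_gradient.continuous.continuousAt.comp continuousAt_fst).eventually_ne
          (Θ₀.gradient_ne_zero hp)
      filter_upwards [hne, hnorm] with b h1 h2
      rw [hΞ, Θ₀.inner_bounce_bounce_of_ne h1, real_inner_self_eq_norm_sq, h2]; norm_num
    have h1 := (hΞc.inner ℝ hΞc).unique ((hasDerivAt_const (0 : ℝ) (1 : ℝ)).congr_of_eventuallyEq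
      (htend.eventually hev))
    rw [hc0, real_inner_comm] at h1
    rw [real_inner_comm]
    linarith
  have hkey := Θ₀.inner_deriv_bounce hp hg hVc hΞc
  obtain ⟨κ, hκ, hcurv⟩ := Θ₀.exists_fderiv_normal_ge
  have hcurv := hcurv p hp h hg
  rw [hc0] at hkey
  have hD0 : inner ℝ h D + τ * ‖D‖ ^ 2 = 0 := by
    have h1 : inner ℝ (h + (τ • D + σ • Ξ (p, ξ))) D = 0 := by rw [hflow, inner_zero_left]
    rw [inner_add_left, inner_add_left, inner_smul_left, inner_smul_left, hunit,
      real_inner_self_eq_norm_sq] at h1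
    simpa using h1
  have hh : h = 0 := by
    by_contra hne
    have h1 : 0 < ‖h‖ ^ 2 := by positivity
    have h2 : 0 < -inner ℝ (Θ₀.normal p) (V (p, ξ)) := by linarith
    have h3 : 0 < -inner ℝ (Θ₀.normal p) (V (p, ξ)) * inner ℝ (fderiv ℝ Θ₀.normal p h) h :=
      mul_pos h2 (lt_of_lt_of_le (by positivity) hcurv)
    have h4 : 0 ≤ τ * ‖D‖ ^ 2 := by positivity
    linarith
  subst hh
  have hD0 : D = 0 := by rw [hD]; exact map_zero _
  rw [hD0, smul_zero, zero_add, zero_add, smul_eq_zero] at hflow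
  have hσ : σ = 0 := by
    refine hflow.resolve_right fun h0 => ?_
    have h1 := (Θ₀.norm_bounce hp (V (p, ξ))).trans hnorm.self_of_nhds
    rw [hΞ] at h0
    simp only at h0
    rw [h0, norm_zero] at h1
    exact zero_ne_one h1
  rw [hσ]; rfl

end Reflection

end TwoObstacles

/-! ### Smooth dependence of the paths -/

namespace TwoObstacles

open Filter Topology

variable {Θ : Fin 2 → Obstacle} {δ : ℝ} {J : List (Fin 2)} {j : Fin 2} {z v x V ξ : Space} {T : ℝ}

theorem isStory_snoc_iff :
    IsStory (J ++ [j]) ↔ IsStory J ∧ ∀ i ∈ J.getLast?, i ≠ j := by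
  simp [IsStory, List.isChain_append]

theorem boundary_disjoint (hΘ : Disjoint (Θ 0).carrier (Θ 1).carrier) {i j : Fin 2} (hij : i ≠ j)
    {p : Space} (hp : p ∈ (Θ j).boundary) : p ∉ (Θ i).boundary := by
  intro hp'
  have h1 := (Θ j).boundary_subset_carrier hp
  have h2 := (Θ i).boundary_subset_carrier hp'
  fin_cases i <;> fin_cases j <;> simp at hij
  · exact Set.disjoint_left.1 hΘ h2 h1
  · exact Set.disjoint_left.1 hΘ h1 h2

/-- `x` does not lie on the last obstacle of the story. -/
def OffLast (Θ : Fin 2 → Obstacle) (J : List (Fin 2)) (x : Space) : Prop :=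
  ∀ i ∈ J.getLast?, x ∉ (Θ i).boundary

theorem OffLast.of_snoc (hΘ : Disjoint (Θ 0).carrier (Θ 1).carrier) (hJ : IsStory (J ++ [j]))
    (hx : x ∈ (Θ j).boundary) : OffLast Θ J x := fun i hi =>
  boundary_disjoint hΘ ((isStory_snoc_iff.1 hJ).2 i hi) hx

theorem SmoothPath.eq {Z V' : Space × Space → Space} {T' : Space × Space → ℝ} (hδ : 0 ≤ δ)
    (hξ : ξ ≠ 0) (h : SmoothPath Θ δ J (x, ξ) Z T' V') (hp : Path Θ δ J z (unit ξ) T x V) :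
    Z (x, ξ) = z ∧ T' (x, ξ) = T ∧ V' (x, ξ) = V :=
  h.path.self_of_nhds.unique hδ hp (norm_unit hξ)

/-- Induction on the last reflection: its point and the remaining length come from the local inverse
of `flowMap`, the incoming direction from the shorter story. Disjointness puts that reflection point
off the previous obstacle, as the induction requires. -/
theorem exists_smoothPath (hΘ : Disjoint (Θ 0).carrier (Θ 1).carrier) (hδ : 0 ≤ δ)
    (hJ : IsStory J) (hξ : ξ ≠ 0) (h : Path Θ δ J z (unit ξ) T x V) (hx : OffLast Θ J x) :
    ∃ Z T' V', SmoothPath Θ δ J (x, ξ) Z T' V' := by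
  induction J using List.reverseRecOn generalizing x V T with
  | nil =>
    refine ⟨Prod.fst, fun _ => 0, fun b => unit b.2, contDiffAt_fst, contDiffAt_const,
      ContDiffAt.comp (g := unit) (x, ξ) (contDiffAt_unit hξ) contDiffAt_snd,
      Eventually.of_forall fun b => ⟨rfl, rfl, rfl⟩⟩
  | append_singleton J j ih =>
    obtain ⟨p, W, τ, h0, h1, hp, hW, hV, hxp⟩ := path_snoc_iff.1 h
    obtain ⟨Z, T', V', hS⟩ := ih (isStory_snoc_iff.1 hJ).1 h1 (OffLast.of_snoc hΘ hJ hp)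
    obtain ⟨eZ, eT, eV⟩ := hS.eq hδ hξ h1
    -- Strict positivity is what keeps the remaining length nonnegative for nearby endpoints; this
    -- is where `OffLast` enters.
    have hτ : 0 < τ := by
      refine h0.lt_of_ne ?_
      rintro rfl
      rw [zero_smul, add_zero] at hxp
      exact hx j (by simp) (hxp ▸ hp)
    have hξev : ∀ᶠ b : Space × Space in 𝓝 (p, ξ), b.2 ≠ 0 :=
      continuousAt_snd.eventually_ne hξ
    have hnorm : ∀ᶠ b in 𝓝 (p, ξ), ‖V' b‖ = 1 := by
      filter_upwards [hS.path, hξev] with b hb hb2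
      rw [hb.ray.norm_eq, norm_unit hb2]
    have hmono : ∀ᶠ b in 𝓝 (p, ξ), b.2 = ξ → 0 ≤ inner ℝ (b.1 - p) (V' b - V' (p, ξ)) := by
      filter_upwards [hS.path] with b hb hb2
      rw [hb2] at hb
      simpa using hS.path.self_of_nhds.ray.inner_sub_sub_le hδ hb.ray (norm_unit hξ)
        (norm_unit hξ)
    obtain ⟨G, hG, hG0, hGev⟩ := exists_local_inverse (contDiffAt_flowMap (τ := τ) hp hS.dir)
      (flowMap_injective hp hS.dir h0 (by rw [eV]; linarith) hnorm hmono)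
    have hval : flowMap (Θ j) V' (p, τ, ξ) = (x, 0, ξ) := by
      simp only [flowMap, eV, ← hV, ← hxp, show (Θ j).defFun p = 0 from hp]
    rw [hval] at hG hG0 hGev
    have hι : ContDiffAt ℝ ∞ (fun b : Space × Space => ((b.1, 0, b.2) : Space × ℝ × Space))
        (x, ξ) := by fun_prop
    have hGι : ContDiffAt ℝ ∞ (fun b : Space × Space => G (b.1, 0, b.2)) (x, ξ) :=
      ContDiffAt.comp (g := G) (x, ξ) hG hι
    have hP : ContDiffAt ℝ ∞ (fun b : Space × Space => ((G (b.1, 0, b.2)).1, b.2)) (x, ξ) :=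
      (contDiffAt_fst.comp (x, ξ) hGι).prodMk contDiffAt_snd
    have hP0 : ((G (x, 0, ξ)).1, ξ) = (p, ξ) := by rw [hG0]
    have hτ' : ContDiffAt ℝ ∞ (fun b : Space × Space => (G (b.1, 0, b.2)).2.1) (x, ξ) :=
      contDiffAt_fst.comp (x, ξ) (contDiffAt_snd.comp (x, ξ) hGι)
    have hcomp {F : Type} [NormedAddCommGroup F] [NormedSpace ℝ F] {f : Space × Space → F}
        (hf : ContDiffAt ℝ ∞ f (p, ξ)) :
        ContDiffAt ℝ ∞ (fun b : Space × Space => f ((G (b.1, 0, b.2)).1, b.2)) (x, ξ) :=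
      ContDiffAt.comp (g := f) (x, ξ) (by rw [hP0]; exact hf) hP
    refine ⟨fun b => Z ((G (b.1, 0, b.2)).1, b.2),
      fun b => T' ((G (b.1, 0, b.2)).1, b.2) + (G (b.1, 0, b.2)).2.1,
      fun b => (Θ j).bounce (G (b.1, 0, b.2)).1 (V' ((G (b.1, 0, b.2)).1, b.2)),
      hcomp hS.start, (hcomp hS.length).add hτ', hcomp (contDiffAt_bounce hp hS.dir), ?_⟩
    have hPt : Tendsto (fun b : Space × Space => ((G (b.1, 0, b.2)).1, b.2)) (𝓝 (x, ξ))
        (𝓝 (p, ξ)) := by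
      have := hP.continuousAt.tendsto
      rwa [hP0] at this
    have hιt : Tendsto (fun b : Space × Space => ((b.1, 0, b.2) : Space × ℝ × Space)) (𝓝 (x, ξ))
        (𝓝 (x, 0, ξ)) := hι.continuousAt.tendsto
    have hτev : ∀ᶠ b : Space × Space in 𝓝 (x, ξ), 0 < (G (b.1, 0, b.2)).2.1 :=
      continuousAt_const.eventually_lt hτ'.continuousAt (by simpa only [hG0] using hτ)
    have hδev : ∀ᶠ b in 𝓝 (p, ξ), δ < -inner ℝ ((Θ j).normal b.1) (V' b) := by
      have hn : ContinuousAt (fun b : Space × Space => (Θ j).normal b.1) (p, ξ) :=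
        ContinuousAt.comp (g := (Θ j).normal) ((Θ j).contDiffAt_normal hp).continuousAt
          continuousAt_fst
      exact continuousAt_const.eventually_lt (hn.inner hS.dir.continuousAt).neg
        (by simpa only [eV] using hW)
    filter_upwards [hPt.eventually hS.path, hPt.eventually hδev, hτev, hιt.eventually hGev]
      with b h2 h3 h4 h5
    simp only [flowMap, Prod.mk.injEq] at h5
    obtain ⟨h6, h7, h8⟩ := h5
    rw [h8] at h6
    exact path_snoc_iff.2 ⟨_, _, _, h4.le, by rwa [add_sub_cancel_right], h7, h3, rfl, h6.symm⟩

end TwoObstacles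

/-! ### The phase as optical length -/

namespace TwoObstacles

open Filter Topology

variable {Θ : Fin 2 → Obstacle} {δ : ℝ} {J : List (Fin 2)} {j : Fin 2}
  {y z v x p V W ξ : Space} {T : ℝ}

theorem phase_snoc : phase Θ δ y (J ++ [j]) ξ = (phase Θ δ y J ξ).reflect (Θ j) δ := by
  simp [phase]

/-- The phase is the optical length along the rays of the story `J`. -/
structure IsRayPhase (Θ : Fin 2 → Obstacle) (δ : ℝ) (y : Space) (J : List (Fin 2)) (ξ : Space)
    (φ : Phase) : Prop where
  mem_dom_iff : ∀ x, x ∈ φ.dom ↔ ∃ z T V, Path Θ δ J z (unit ξ) T x V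
  val_eq : ∀ {z T x V}, Path Θ δ J z (unit ξ) T x V → φ.val x = inner ℝ (z - y) (unit ξ) + T

section

variable {φ : Phase} (hΘ : Disjoint (Θ 0).carrier (Θ 1).carrier) (hδ : 0 ≤ δ) (hξ : ξ ≠ 0)

theorem SmoothPath.eventually_path {Z V' : Space × Space → Space} {T' : Space × Space → ℝ}
    (h : SmoothPath Θ δ J (x, ξ) Z T' V') :
    ∀ᶠ x' in 𝓝 x, Path Θ δ J (Z (x', ξ)) (unit ξ) (T' (x', ξ)) x' (V' (x', ξ)) :=
  (Continuous.prodMk_left ξ).continuousAt.eventually h.path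

theorem contDiffAt_left {F : Type*} [NormedAddCommGroup F] [NormedSpace ℝ F]
    {f : Space × Space → F} (h : ContDiffAt ℝ ∞ f (x, ξ)) :
    ContDiffAt ℝ ∞ (fun x' => f (x', ξ)) x :=
  ContDiffAt.comp (g := f) x h (contDiffAt_id.prodMk contDiffAt_const)

theorem contDiffAt_right {F : Type*} [NormedAddCommGroup F] [NormedSpace ℝ F]
    {f : Space × Space → F} (h : ContDiffAt ℝ ∞ f (x, ξ)) :
    ContDiffAt ℝ ∞ (fun ξ' => f (x, ξ')) ξ :=
  ContDiffAt.comp (g := f) ξ h (contDiffAt_const.prodMk contDiffAt_id)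

include hΘ hδ hξ

theorem IsRayPhase.contDiffAt (hφ : IsRayPhase Θ δ y J ξ φ) (hJ : IsStory J)
    (h : Path Θ δ J z (unit ξ) T x V) (hx : OffLast Θ J x) : ContDiffAt ℝ ∞ φ.val x := by
  obtain ⟨Z, T', V', hS⟩ := exists_smoothPath hΘ hδ hJ hξ h hx
  have h1 := ((contDiffAt_left hS.start).sub (contDiffAt_const (c := y))).inner ℝ
    (contDiffAt_const (c := unit ξ)) |>.add (contDiffAt_left hS.length)
  refine h1.congr_of_eventuallyEq ?_
  filter_upwards [hS.eventually_path] with x' hx' using hφ.val_eq hx'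

theorem IsRayPhase.mem_interior (hφ : IsRayPhase Θ δ y J ξ φ) (hJ : IsStory J)
    (h : Path Θ δ J z (unit ξ) T x V) (hx : OffLast Θ J x) : x ∈ interior φ.dom := by
  obtain ⟨Z, T', V', hS⟩ := exists_smoothPath hΘ hδ hJ hξ h hx
  rw [mem_interior_iff_mem_nhds]
  filter_upwards [hS.eventually_path] with x' hx' using (hφ.mem_dom_iff x').2 ⟨_, _, _, hx'⟩

theorem IsRayPhase.hasGradientAt (hφ : IsRayPhase Θ δ y J ξ φ) (hJ : IsStory J)
    (h : Path Θ δ J z (unit ξ) T x V) (hx : OffLast Θ J x) : HasGradientAt φ.val V x := by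
  obtain ⟨Z, T', V', hS⟩ := exists_smoothPath hΘ hδ hJ hξ h hx
  have hd := ((hφ.contDiffAt hΘ hδ hξ hJ h hx).differentiableAt (by simp)).hasFDerivAt
  have hd2 := hd.sub (InnerProductSpace.toDual ℝ Space V).hasFDerivAt
  -- For equal initial directions the Fermat principle reads `⟨V, x' - x⟩ ≤ φ x' - φ x`, so `V` is a
  -- local subgradient at a point of differentiability.
  have hmin : IsLocalMin (φ.val - ⇑(InnerProductSpace.toDual ℝ Space V)) x := by
    filter_upwards [hS.eventually_path] with x' hx'
    have h1 := h.ray.inner_sub_le hδ hx'.ray (norm_unit hξ) (norm_unit hξ)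
    simp only [Pi.sub_apply, InnerProductSpace.toDual_apply_apply, hφ.val_eq h, hφ.val_eq hx']
    simp only [inner_sub_right, inner_sub_left, real_inner_comm _ (unit ξ)] at h1 ⊢
    linarith
  have h3 := hmin.hasFDerivAt_eq_zero hd2
  rw [sub_eq_zero] at h3
  rw [hasGradientAt_iff_hasFDerivAt, ← h3]
  exact hd

theorem IsRayPhase.gradient_eq (hφ : IsRayPhase Θ δ y J ξ φ) (hJ : IsStory J)
    (h : Path Θ δ J z (unit ξ) T x V) (hx : OffLast Θ J x) : gradient φ.val x = V :=
  (hφ.hasGradientAt hΘ hδ hξ hJ h hx).gradient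

theorem IsRayPhase.mem_incoming (hφ : IsRayPhase Θ δ y J ξ φ) (hJ : IsStory (J ++ [j]))
    (h : Path Θ δ J z (unit ξ) T p W) (hp : p ∈ (Θ j).boundary)
    (hW : δ < -inner ℝ ((Θ j).normal p) W) : p ∈ φ.incoming (Θ j) δ :=
  ⟨hp, (hφ.mem_dom_iff p).2 ⟨_, _, _, h⟩, by
    rwa [hφ.gradient_eq hΘ hδ hξ (isStory_snoc_iff.1 hJ).1 h (OffLast.of_snoc hΘ hJ hp)]⟩

theorem IsRayPhase.exists_path (hφ : IsRayPhase Θ δ y J ξ φ) (hJ : IsStory (J ++ [j]))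
    {τ : ℝ} (h : φ.Reaches (Θ j) δ x p τ) : ∃ z T V, Path Θ δ (J ++ [j]) z (unit ξ) T x V ∧
      φ.val p + τ = inner ℝ (z - y) (unit ξ) + T := by
  obtain ⟨⟨hp, hdom, hW⟩, hτ, hx⟩ := h
  obtain ⟨z, T, W, hpath⟩ := (hφ.mem_dom_iff p).1 hdom
  rw [hφ.gradient_eq hΘ hδ hξ (isStory_snoc_iff.1 hJ).1 hpath (OffLast.of_snoc hΘ hJ hp)] at hW hx
  refine ⟨z, T + τ, _, path_snoc_iff.2 ⟨p, W, τ, hτ, by rwa [add_sub_cancel_right], hp, hW, rfl,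
    hx⟩, ?_⟩
  rw [hφ.val_eq hpath, add_assoc]

theorem IsRayPhase.reflect (hφ : IsRayPhase Θ δ y J ξ φ) (hJ : IsStory (J ++ [j])) :
    IsRayPhase Θ δ y (J ++ [j]) ξ (φ.reflect (Θ j) δ) := by
  have hreach : ∀ {x z T V}, Path Θ δ (J ++ [j]) z (unit ξ) T x V →
      ∃ p τ, φ.Reaches (Θ j) δ x p τ := by
    intro x z T V h
    obtain ⟨p, W, τ, h0, h1, hp, hW, hV, hx⟩ := path_snoc_iff.1 h
    refine ⟨p, τ, hφ.mem_incoming hΘ hδ hξ hJ h1 hp hW, h0, ?_⟩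
    rw [hφ.gradient_eq hΘ hδ hξ (isStory_snoc_iff.1 hJ).1 h1 (OffLast.of_snoc hΘ hJ hp), hx, hV]
  constructor
  · intro x
    constructor
    · rintro ⟨p, τ, h⟩
      obtain ⟨z, T, V, h1, -⟩ := hφ.exists_path hΘ hδ hξ hJ h
      exact ⟨z, T, V, h1⟩
    · rintro ⟨z, T, V, h⟩
      exact hreach h
  · intro z T x V h
    obtain ⟨p, τ, hpτ⟩ := hreach h
    have hex : ∃ a : Space × ℝ, φ.Reaches (Θ j) δ x a.1 a.2 := ⟨(p, τ), hpτ⟩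
    obtain ⟨z', T', V', h1, h2⟩ := hφ.exists_path hΘ hδ hξ hJ hex.choose_spec
    -- The reflection point chosen in `Phase.reflect` is immaterial, because the path is unique.
    obtain ⟨rfl, rfl, -⟩ := h.unique hδ h1 (norm_unit hξ)
    rw [← h2]
    exact dif_pos hex

theorem isRayPhase (hJ : IsStory J) : IsRayPhase Θ δ y J ξ (phase Θ δ y J ξ) := by
  induction J using List.reverseRecOn with
  | nil =>
    refine ⟨fun x => ⟨fun _ => ⟨x, 0, unit ξ, rfl, rfl, rfl⟩, fun _ => Set.mem_univ _⟩, ?_⟩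
    rintro z T x V ⟨rfl, rfl, rfl⟩
    simp only [phase, List.foldl_nil, planePhase, unit, inner_smul_right, add_zero]
    rw [div_eq_inv_mul]
  | append_singleton J j ih =>
    rw [phase_snoc]
    exact (ih (isStory_snoc_iff.1 hJ).1).reflect hΘ hδ hξ hJ

end

end TwoObstacles

/-! ### Critical points of the action -/

namespace TwoObstacles

open Filter Topology

variable {Θ : Fin 2 → Obstacle} {δ : ℝ} {J : List (Fin 2)} {j : Fin 2}
  {y z v x p V W ξ : Space} {T : ℝ}

/-- Near `ξ` there are paths with endpoint `x`, whose initial point and length depend smoothly on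
the direction. -/
structure SmoothDir (Θ : Fin 2 → Obstacle) (δ : ℝ) (J : List (Fin 2)) (x ξ : Space)
    (Z : Space → Space) (T : Space → ℝ) : Prop where
  start : ContDiffAt ℝ ∞ Z ξ
  length : ContDiffAt ℝ ∞ T ξ
  path : ∀ᶠ η in 𝓝 ξ, ∃ V, Path Θ δ J (Z η) (unit η) (T η) x V

theorem SmoothPath.eventually_path_dir {Z V' : Space × Space → Space} {T' : Space × Space → ℝ}
    (h : SmoothPath Θ δ J (x, ξ) Z T' V') :
    ∀ᶠ η in 𝓝 ξ, Path Θ δ J (Z (x, η)) (unit η) (T' (x, η)) x (V' (x, η)) :=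
  (Continuous.prodMk_right x).continuousAt.eventually h.path

/-- With `x` fixed, endpoints on the last obstacle are allowed too: there the last reflection takes
place at `x` itself, so it suffices to vary the path of the shorter story and to keep the strict
incidence condition. -/
theorem exists_smoothDir (hΘ : Disjoint (Θ 0).carrier (Θ 1).carrier) (hδ : 0 ≤ δ) (hξ : ξ ≠ 0)
    (hJ : IsStory J) (h : Path Θ δ J z (unit ξ) T x V) : ∃ Z T', SmoothDir Θ δ J x ξ Z T' := by
  by_cases hx : OffLast Θ J x
  · obtain ⟨Z, T', V', hS⟩ := exists_smoothPath hΘ hδ hJ hξ h hx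
    refine ⟨fun η => Z (x, η), fun η => T' (x, η), contDiffAt_right hS.start,
      contDiffAt_right hS.length, ?_⟩
    filter_upwards [hS.eventually_path_dir] with η hη using ⟨_, hη⟩
  · cases J using List.reverseRecOn with
    | nil => exact absurd (fun i hi => by simp at hi) hx
    | append_singleton J j =>
      obtain ⟨p, W, τ, h0, h1, hp, hW, hV, hxp⟩ := path_snoc_iff.1 h
      have hxj : x ∈ (Θ j).boundary := by simpa [OffLast] using hx
      -- The reflected ray leaves the supporting half-space at once and cannot return to the convex
      -- obstacle.
      have hτ : τ = 0 := by
        have h2 := (Θ j).inner_normal_sub_nonpos hp ((Θ j).boundary_subset_carrier hxj)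
        have h3 : inner ℝ ((Θ j).normal p) V = -inner ℝ ((Θ j).normal p) W := by
          rw [hV, real_inner_comm, (Θ j).inner_bounce, (Θ j).inner_normal_normal hp,
            real_inner_comm W]
          ring
        rw [hxp, add_sub_cancel_left, inner_smul_right, h3] at h2
        nlinarith
      rw [hτ, zero_smul, add_zero] at hxp
      subst hxp
      obtain ⟨Z, T', V', hS⟩ := exists_smoothPath hΘ hδ (isStory_snoc_iff.1 hJ).1 hξ h1
        (OffLast.of_snoc hΘ hJ hp)
      obtain ⟨eZ, eT, eV⟩ := hS.eq hδ hξ h1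
      refine ⟨fun η => Z (x, η), fun η => T' (x, η), contDiffAt_right hS.start,
        contDiffAt_right hS.length, ?_⟩
      have hev : ∀ᶠ η in 𝓝 ξ, δ < -inner ℝ ((Θ j).normal x) (V' (x, η)) :=
        continuousAt_const.eventually_lt
          (continuousAt_const.inner (contDiffAt_right hS.dir).continuousAt).neg
          (by simpa only [eV] using hW)
      filter_upwards [hS.eventually_path_dir, hev] with η h3 h4
      exact ⟨_, path_snoc_iff.2 ⟨x, V' (x, η), 0, le_rfl, by rwa [sub_zero], hp, h4, rfl,
        by simp⟩⟩

theorem mem_frequencies_iff (hΘ : Disjoint (Θ 0).carrier (Θ 1).carrier) (hδ : 0 ≤ δ)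
    (hJ : IsStory J) : ξ ∈ frequencies Θ δ y J x ↔
      ξ ≠ 0 ∧ ∃ z T V, Path Θ δ J z (unit ξ) T x V := by
  constructor
  · rintro ⟨h1, h2⟩
    exact ⟨h1, ((isRayPhase hΘ hδ h1 hJ).mem_dom_iff x).1 h2⟩
  · rintro ⟨h1, h2⟩
    exact ⟨h1, ((isRayPhase hΘ hδ h1 hJ).mem_dom_iff x).2 h2⟩

theorem inner_unit_mul_norm (hξ : ξ ≠ 0) (z : Space) :
    inner ℝ z (unit ξ) * ‖ξ‖ = inner ℝ z ξ := by
  conv_rhs => rw [← norm_smul_unit hξ, inner_smul_right]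
  ring

theorem actionPhase_eq (hΘ : Disjoint (Θ 0).carrier (Θ 1).carrier) (hδ : 0 ≤ δ)
    (hJ : IsStory J) (hξ : ξ ≠ 0) (h : Path Θ δ J z (unit ξ) T x V) (t : ℝ) :
    actionPhase Θ δ y J x t ξ = inner ℝ (z - y) ξ + T * ‖ξ‖ - t * ‖ξ‖ ^ 2 := by
  rw [actionPhase, (isRayPhase hΘ hδ hξ hJ).val_eq h, add_mul, inner_unit_mul_norm hξ]

theorem SmoothDir.actionPhase_eventuallyEq {Z : Space → Space} {T : Space → ℝ}
    (hΘ : Disjoint (Θ 0).carrier (Θ 1).carrier) (hδ : 0 ≤ δ) (hJ : IsStory J) (hξ : ξ ≠ 0)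
    (hpath : ∀ᶠ η in 𝓝 ξ, ∃ V, Path Θ δ J (Z η) (unit η) (T η) x V) (t : ℝ) :
    actionPhase Θ δ y J x t =ᶠ[𝓝 ξ]
      fun η => inner ℝ (Z η - y) η + T η * ‖η‖ - t * ‖η‖ ^ 2 := by
  filter_upwards [hpath, isOpen_ne.mem_nhds hξ] with η hη h0
  obtain ⟨V, hV⟩ := hη
  exact actionPhase_eq hΘ hδ hJ h0 hV t

theorem SmoothDir.contDiffAt {Z : Space → Space} {T : Space → ℝ}
    (hΘ : Disjoint (Θ 0).carrier (Θ 1).carrier) (hδ : 0 ≤ δ) (hJ : IsStory J) (hξ : ξ ≠ 0)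
    (h : SmoothDir Θ δ J x ξ Z T) (t : ℝ) : ContDiffAt ℝ ∞ (actionPhase Θ δ y J x t) ξ := by
  refine ContDiffAt.congr_of_eventuallyEq ?_
    (SmoothDir.actionPhase_eventuallyEq hΘ hδ hJ hξ h.path t)
  exact (((h.start.sub contDiffAt_const).inner ℝ contDiffAt_id).add
    (h.length.mul (contDiffAt_norm ℝ hξ))).sub
    (contDiffAt_const.mul (contDiffAt_id.norm_sq ℝ))

theorem hasFDerivAt_norm' (hξ : ξ ≠ 0) :
    HasFDerivAt (fun η : Space => ‖η‖) (innerSL ℝ (unit ξ)) ξ := by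
  have h1 := ((contDiffAt_norm ℝ hξ (n := 1)).differentiableAt (by simp)).hasFDerivAt
  have h2 := h1.pow 2
  have h3 := h2.unique (hasStrictFDerivAt_norm_sq ξ).hasFDerivAt
  refine h1.congr_fderiv (ContinuousLinearMap.ext fun η => ?_)
  have h4 := DFunLike.congr_fun h3 η
  have h5 : ‖ξ‖ ≠ 0 := norm_ne_zero_iff.2 hξ
  simp at h4
  simp only [innerSL_apply_apply, unit, inner_smul_left, conj_trivial]
  field_simp
  linarith

/-- An envelope relation: by the Fermat principle with common endpoint `x`, the function `⟨unit ξ, Z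
η⟩ + T η` of `η` is minimal at `ξ`. -/
theorem inner_unit_fderiv {Z : Space → Space} {T : Space → ℝ} (hδ : 0 ≤ δ) (hξ : ξ ≠ 0)
    (hZ : DifferentiableAt ℝ Z ξ) (hT : DifferentiableAt ℝ T ξ)
    (hpath : ∀ᶠ η in 𝓝 ξ, ∃ V, Path Θ δ J (Z η) (unit η) (T η) x V) (η : Space) :
    inner ℝ (unit ξ) (fderiv ℝ Z ξ η) + fderiv ℝ T ξ η = 0 := by
  have hmin : IsLocalMin (fun η => inner ℝ (unit ξ) (Z η) + T η) ξ := by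
    obtain ⟨V, hV⟩ := hpath.self_of_nhds
    filter_upwards [hpath, isOpen_ne.mem_nhds hξ] with η hη h0
    obtain ⟨V', hV'⟩ := hη
    have h1 := hV.ray.inner_sub_le hδ hV'.ray (norm_unit hξ) (norm_unit h0)
    simp only [sub_self, inner_zero_right, inner_sub_right] at h1
    linarith
  have hcrit := hmin.hasFDerivAt_eq_zero
    (((hasFDerivAt_const (unit ξ) ξ).inner ℝ hZ.hasFDerivAt).add hT.hasFDerivAt)
  simpa using DFunLike.congr_fun hcrit η

theorem hasGradientAt_actionPhase {Z : Space → Space} {T : Space → ℝ}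
    (hΘ : Disjoint (Θ 0).carrier (Θ 1).carrier) (hδ : 0 ≤ δ) (hJ : IsStory J) (hξ : ξ ≠ 0)
    (hZ : DifferentiableAt ℝ Z ξ) (hT : DifferentiableAt ℝ T ξ)
    (hpath : ∀ᶠ η in 𝓝 ξ, ∃ V, Path Θ δ J (Z η) (unit η) (T η) x V) (t : ℝ) :
    HasGradientAt (actionPhase Θ δ y J x t) (Z ξ + T ξ • unit ξ - y - (2 * t) • ξ) ξ := by
  rw [hasGradientAt_iff_hasFDerivAt]
  have h1 := (((hZ.hasFDerivAt.sub_const y).inner ℝ (hasFDerivAt_id ξ)).add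
    (hT.hasFDerivAt.mul (hasFDerivAt_norm' hξ))).sub
    ((hasStrictFDerivAt_norm_sq ξ).hasFDerivAt.const_mul t)
  refine (h1.congr_fderiv ?_).congr_of_eventuallyEq
    (SmoothDir.actionPhase_eventuallyEq hΘ hδ hJ hξ hpath t)
  ext η
  have h2 := inner_unit_fderiv hδ hξ hZ hT hpath η
  have h3 := inner_unit_mul_norm hξ (fderiv ℝ Z ξ η)
  simp [inner_sub_left] at h2 ⊢
  rw [real_inner_comm] at h2
  linear_combination ‖ξ‖ * h2 - h3

/-- A critical point is a frequency for which the ray, prolonged backwards by the time `2t`, starts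
at `y`. -/
theorem isCritical_iff (hΘ : Disjoint (Θ 0).carrier (Θ 1).carrier) (hδ : 0 ≤ δ)
    (hJ : IsStory J) (hξ : ξ ≠ 0) (h : Path Θ δ J z (unit ξ) T x V) (t : ℝ) :
    IsCritical Θ δ y J x t ξ ↔ z + T • unit ξ = y + (2 * t) • ξ := by
  obtain ⟨Z, T', hS⟩ := exists_smoothDir hΘ hδ hξ hJ h
  have h1 := hasGradientAt_actionPhase (y := y) hΘ hδ hJ hξ (hS.start.differentiableAt (by simp))
    (hS.length.differentiableAt (by simp)) hS.path t
  obtain ⟨V', hV'⟩ := hS.path.self_of_nhds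
  obtain ⟨eZ, eT, -⟩ := hV'.unique hδ h (norm_unit hξ)
  rw [eZ, eT] at h1
  rw [← sub_eq_zero, ← sub_sub]
  constructor
  · intro hc
    exact h1.unique hc.2
  · intro hc
    rw [hc] at h1
    exact ⟨(mem_frequencies_iff hΘ hδ hJ).2 ⟨hξ, z, T, V, h⟩, h1⟩

theorem not_isBehind_nil : ¬ IsBehind Θ [] y ξ := by
  rintro ⟨j, hj, -⟩
  simp at hj

/-- Before an entry point, the incoming line is strictly outside the supporting half-space there. -/
theorem not_isBehind (h0 : ξ ≠ 0) {s : ℝ} (hs : 0 ≤ s) (hp : y + s • unit ξ ∈ (Θ j).boundary)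
    (hin : inner ℝ ((Θ j).normal (y + s • unit ξ)) (unit ξ) < 0) : ¬ IsBehind Θ (j :: J) y ξ := by
  rintro ⟨i, hi, s', hs', hc⟩
  obtain rfl : j = i := by simpa using hi
  have hr : 0 < ‖ξ‖ := norm_pos_iff.2 h0
  have h1 := (Θ j).inner_normal_sub_nonpos hp hc
  have h2 : s' • ξ = (s' * ‖ξ‖) • unit ξ := by rw [mul_smul, norm_smul_unit h0]
  have h3 : y - s' • ξ - (y + s • unit ξ) = -((s' * ‖ξ‖ + s) • unit ξ) := by
    rw [h2]; module
  rw [h3, inner_neg_right, inner_smul_right] at h1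
  have : 0 < s' * ‖ξ‖ + s := by positivity
  nlinarith

theorem isCritical_and_not_isBehind_iff (hΘ : Disjoint (Θ 0).carrier (Θ 1).carrier) (hδ : 0 ≤ δ)
    (hJ : IsStory J) {t : ℝ} (ht : 0 < t) (hξ : ξ ∈ frequencies Θ δ y J x) :
    (IsCritical Θ δ y J x t ξ ∧ ¬ IsBehind Θ J y ξ) ↔ RayReaches Θ J y ξ (2 * t) x := by
  obtain ⟨h0, z, T, V, h⟩ := (mem_frequencies_iff hΘ hδ hJ).1 hξ
  have hr : 0 < ‖ξ‖ := norm_pos_iff.2 h0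
  have hray : RayReaches Θ J y ξ (2 * t) x ↔ ∃ V, Ray Θ 0 J y (unit ξ) (‖ξ‖ * (2 * t)) x V := by
    rw [← rayReaches_iff hr, norm_smul_unit h0]
  have hlen : (‖ξ‖ * (2 * t)) • unit ξ = (2 * t) • ξ := by
    rw [mul_comm, mul_smul, norm_smul_unit h0]
  rw [isCritical_iff hΘ hδ hJ h0 h, hray]
  constructor
  · rintro ⟨h1, h2⟩
    cases J with
    | nil =>
      obtain ⟨rfl, rfl, rfl⟩ := h
      exact ⟨_, by positivity, by rw [hlen, ← h1]; simp, rfl⟩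
    | cons j J =>
      -- The signed length from `y` to the first reflection point; if it were negative, that point
      -- would witness that `y` is behind the obstacle.
      set s := ‖ξ‖ * (2 * t) - T with hs
      have hz : z = y + s • unit ξ := by
        rw [hs, sub_smul, hlen, ← add_sub_assoc, ← h1, add_sub_cancel_right]
      have hs0 : 0 ≤ s := by
        by_contra! hneg
        refine h2 ⟨j, by simp, -s / ‖ξ‖, div_pos (by linarith) hr, ?_⟩
        refine (Θ j).boundary_subset_carrier ?_
        have h3 : y - (-s / ‖ξ‖) • ξ = z := by
          rw [hz, unit, smul_smul, neg_div, neg_smul, sub_neg_eq_add, div_eq_mul_inv]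
        rw [h3]
        exact h.1
      obtain ⟨h3, h4, h5⟩ := h.mono hδ
      rw [hz] at h3 h4 h5
      refine ⟨V, s, hs0, h3, h4, ?_⟩
      rw [hs, sub_sub_cancel, ← hs]
      exact h5
  · rintro ⟨V', hV'⟩
    refine ⟨?_, ?_⟩
    -- The given ray is only known to be transversal, so the comparison with the path is made at `δ
    -- = 0`.
    · rw [((h.mono hδ).ray.unique le_rfl hV' (norm_unit h0)).1, hlen]
    · cases J with
      | nil => exact not_isBehind_nil
      | cons i J =>
        obtain ⟨s', h1, h2, h3, -⟩ := hV'
        exact not_isBehind h0 h1 h2 (by linarith)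

theorem subsingleton_isCritical (hΘ : Disjoint (Θ 0).carrier (Θ 1).carrier) (hδ : 0 ≤ δ)
    (hJ : IsStory J) {t : ℝ} (ht : 0 < t) :
    {ξ | IsCritical Θ δ y J x t ξ ∧ ¬ IsBehind Θ J y ξ}.Subsingleton := by
  intro ξ hξ ξ' hξ'
  have hc := (isCritical_and_not_isBehind_iff hΘ hδ hJ ht hξ.1.1).1 hξ
  have hc' := (isCritical_and_not_isBehind_iff hΘ hδ hJ ht hξ'.1.1).1 hξ'
  have h0 := hξ.1.1.1
  have h0' := hξ'.1.1.1
  have hr : 0 < ‖ξ‖ := norm_pos_iff.2 h0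
  rw [← norm_smul_unit h0, rayReaches_iff hr] at hc
  rw [← norm_smul_unit h0', rayReaches_iff (norm_pos_iff.2 h0')] at hc'
  obtain ⟨V, hV⟩ := hc
  obtain ⟨V', hV'⟩ := hc'
  obtain ⟨h1, h2⟩ := hV.unique_of_start le_rfl hV' (norm_unit h0) (norm_unit h0') (by positivity)
  rw [← norm_smul_unit h0, ← norm_smul_unit h0', h2,
    mul_right_cancel₀ (by positivity : 2 * t ≠ 0) h1]

end TwoObstacles

/-! ### Lower bound for the Hessian determinant -/

namespace TwoObstacles

open Filter Topology

variable {Θ : Fin 2 → Obstacle} {δ : ℝ} {J : List (Fin 2)} {j : Fin 2}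
  {y z v x p V W ξ : Space} {T : ℝ}

theorem pow_le_det_of_le {A : Matrix (Fin 3) (Fin 3) ℝ} (hA : A.IsHermitian) {m : ℝ} (hm : 0 ≤ m)
    (h : ∀ v : Space, m * ‖v‖ ^ 2 ≤ dotProduct ⇑v (A.mulVec v)) : m ^ 3 ≤ A.det := by
  rw [hA.det_eq_prod_eigenvalues]
  have h1 : ∀ i, m ≤ hA.eigenvalues i := by
    intro i
    have h2 := h (hA.eigenvectorBasis i)
    rw [hA.eigenvectorBasis.orthonormal.1 i] at h2
    rw [hA.eigenvalues_eq]
    simpa using h2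
  calc m ^ 3 = ∏ _i : Fin 3, m := by simp
    _ ≤ _ := Finset.prod_le_prod (fun _ _ => hm) fun i _ => by simpa using h1 i

theorem norm_smul_fderiv_unit (hξ : ξ ≠ 0) (η : Space) :
    ‖ξ‖ • fderiv ℝ unit ξ η + inner ℝ (unit ξ) η • unit ξ = η := by
  have h1 := (hasFDerivAt_norm' hξ).smul
    ((contDiffAt_unit hξ).differentiableAt (by simp)).hasFDerivAt
  have h2 : HasFDerivAt (fun η : Space => ‖η‖ • unit η) (ContinuousLinearMap.id ℝ Space) ξ :=
    (hasFDerivAt_id ξ).congr_of_eventuallyEq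
      (by filter_upwards [isOpen_ne.mem_nhds hξ] with η hη using norm_smul_unit hη)
  simpa using DFunLike.congr_fun (h1.unique h2) η

theorem inner_fderiv_unit (hξ : ξ ≠ 0) (η : Space) :
    inner ℝ (fderiv ℝ unit ξ η) (unit ξ) = 0 := by
  have h1 := ((contDiffAt_unit hξ).differentiableAt (by simp)).hasFDerivAt
  have h2 : HasFDerivAt (fun η : Space => inner ℝ (unit η) (unit η)) (0 : Space →L[ℝ] ℝ) ξ :=
    (hasFDerivAt_const (1 : ℝ) ξ).congr_of_eventuallyEq
      (by filter_upwards [isOpen_ne.mem_nhds hξ] with η hη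
          rw [real_inner_self_eq_norm_sq, norm_unit hη]; norm_num)
  have h3 := DFunLike.congr_fun ((h1.inner ℝ h1).unique h2) η
  simpa [real_inner_comm (fderiv ℝ unit ξ η)] using h3

/-- The prolonged starting point of the ray depends on the frequency in a dissipative way. -/
theorem inner_fderiv_start_le {Z : Space → Space} {T : Space → ℝ} (hδ : 0 ≤ δ) (hξ : ξ ≠ 0)
    (hZ : DifferentiableAt ℝ Z ξ) (hT : DifferentiableAt ℝ T ξ) (hT0 : 0 ≤ T ξ)
    (hpath : ∀ᶠ η in 𝓝 ξ, ∃ V, Path Θ δ J (Z η) (unit η) (T η) x V) (η : Space) :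
    inner ℝ (fderiv ℝ (fun η => Z η + T η • unit η) ξ η) η ≤ T ξ / ‖ξ‖ * ‖η‖ ^ 2 := by
  have hu := (contDiffAt_unit hξ).differentiableAt (n := ∞) (by simp)
  set Q : Space → Space := fun η => Z η + T η • unit η with hQ
  set u := unit ξ with hu'
  set D := fderiv ℝ unit ξ η with hD
  have hQd : HasFDerivAt Q (fderiv ℝ Q ξ) ξ := (hZ.add (hT.smul hu)).hasFDerivAt
  have hcomp {f : Space → Space} {f' : Space →L[ℝ] Space} (hf : HasFDerivAt f f' ξ) :
      HasDerivAt (fun s : ℝ => f (ξ + s • η)) (f' η) 0 := by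
    have h1 : HasFDerivAt f f' (ξ + (0 : ℝ) • η) := by simpa using hf
    exact h1.comp_hasDerivAt 0 (hasDerivAt_add_smul ξ η 0)
  have htend : Tendsto (fun s : ℝ => ξ + s • η) (𝓝 0) (𝓝 ξ) := by
    simpa using (hasDerivAt_add_smul ξ η 0).continuousAt.tendsto
  have hk : ContinuousAt (fun s : ℝ => (T ξ + T (ξ + s • η)) / 2) 0 := by
    have h1 : ContinuousAt T (ξ + (0 : ℝ) • η) := by simpa using hT.continuousAt
    exact (continuousAt_const.add
      (h1.comp (f := fun s : ℝ => ξ + s • η) (hasDerivAt_add_smul ξ η 0).continuousAt)).div_const 2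
  obtain ⟨V, hV⟩ := hpath.self_of_nhds
  have hdiss := inner_deriv_le (hcomp hQd) (hcomp hu.hasFDerivAt) hk (by
    filter_upwards [htend.eventually hpath, htend.eventually (isOpen_ne.mem_nhds hξ)]
      with s hs hs0
    obtain ⟨V', hV'⟩ := hs
    set ξ' := ξ + s • η
    have h1 := hV.ray.inner_sub_sub_le hδ hV'.ray (norm_unit hξ) (norm_unit hs0)
    simp only [sub_self, inner_zero_left, zero_smul, add_zero] at h1 ⊢
    have h2 : inner ℝ (unit ξ) (unit ξ) = 1 := by
      rw [real_inner_self_eq_norm_sq, norm_unit hξ]; norm_num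
    have h3 : inner ℝ (unit ξ') (unit ξ') = 1 := by
      rw [real_inner_self_eq_norm_sq, norm_unit hs0]; norm_num
    rw [← real_inner_self_eq_norm_sq]
    have h4 : Q ξ' - Q ξ = (Z ξ' - Z ξ) + (T ξ' • unit ξ' - T ξ • unit ξ) := by
      simp only [hQ]; abel
    rw [h4, inner_add_left]
    -- Both directions are unit vectors, so both sides equal `(T ξ + T ξ') (1 - ⟨unit ξ, unit ξ'⟩)`.
    -- The other part of the increment has nonpositive pairing, by monotonicity at the common
    -- endpoint.
    have h5 : inner ℝ (T ξ' • unit ξ' - T ξ • unit ξ) (unit ξ' - unit ξ)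
        = (T ξ + T ξ') / 2 * inner ℝ (unit ξ' - unit ξ) (unit ξ' - unit ξ) := by
      simp only [inner_sub_left, inner_sub_right, inner_smul_left, h2, h3,
        real_inner_comm (unit ξ') (unit ξ), conj_trivial]
      ring
    linarith)
  simp only [zero_smul, add_zero] at hdiss
  rw [← hD] at hdiss
  have hr : 0 < ‖ξ‖ := norm_pos_iff.2 hξ
  have hη := norm_smul_fderiv_unit hξ η
  rw [← hD, ← hu'] at hη
  have hDu : inner ℝ D u = 0 := inner_fderiv_unit hξ η
  -- By the envelope relation the starting point varies orthogonally to the ray, so only the angular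
  -- part of `η` contributes.
  have hQu : inner ℝ (fderiv ℝ Q ξ η) u = 0 := by
    have h1 := (hZ.hasFDerivAt.add (hT.hasFDerivAt.smul hu.hasFDerivAt)).unique hQd
    have h2 := inner_unit_fderiv hδ hξ hZ hT hpath η
    have h3 : inner ℝ u u = 1 := by
      rw [real_inner_self_eq_norm_sq, norm_unit hξ]; norm_num
    rw [← h1]
    simp only [add_apply, smul_apply,
      ContinuousLinearMap.smulRight_apply, inner_add_left, inner_smul_left, ← hD, hDu, ← hu', h3,
      conj_trivial]
    rw [real_inner_comm] at h2
    linarith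
  have h1 : inner ℝ (fderiv ℝ Q ξ η) η = ‖ξ‖ * inner ℝ (fderiv ℝ Q ξ η) D := by
    calc inner ℝ (fderiv ℝ Q ξ η) η = inner ℝ (fderiv ℝ Q ξ η) (‖ξ‖ • D + inner ℝ u η • u) := by
          rw [hη]
      _ = _ := by rw [inner_add_right, inner_smul_right, inner_smul_right, hQu]; ring
  have h2 : ‖η‖ ^ 2 = ‖ξ‖ ^ 2 * ‖D‖ ^ 2 + inner ℝ u η ^ 2 := by
    have h3 : inner ℝ η η = ‖ξ‖ * inner ℝ D η + inner ℝ u η * inner ℝ u η := by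
      conv_lhs => enter [2]; rw [← hη]
      rw [inner_add_left, inner_smul_left, inner_smul_left]; simp
    have h4 : inner ℝ D η = ‖ξ‖ * ‖D‖ ^ 2 := by
      rw [← hη, inner_add_right, inner_smul_right, inner_smul_right, hDu,
        real_inner_self_eq_norm_sq]; ring
    rw [← real_inner_self_eq_norm_sq, h3, h4]; ring
  rw [h1, h2]
  have h3 : T ξ / ‖ξ‖ * (‖ξ‖ ^ 2 * ‖D‖ ^ 2 + inner ℝ u η ^ 2)
      = ‖ξ‖ * (T ξ * ‖D‖ ^ 2) + T ξ / ‖ξ‖ * inner ℝ u η ^ 2 := by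
    field_simp
  rw [h3]
  have h4 : 0 ≤ T ξ / ‖ξ‖ * inner ℝ u η ^ 2 := by positivity
  have h5 : (T ξ + T ξ) / 2 = T ξ := by ring
  rw [h5] at hdiss
  nlinarith [mul_le_mul_of_nonneg_left hdiss hr.le]

/-- Minus the Hessian is symmetric and at least `2t - T/‖ξ‖` as a quadratic form, so its three
eigenvalues are at least `m`. -/
theorem pow_le_hessianDet (hΘ : Disjoint (Θ 0).carrier (Θ 1).carrier) (hδ : 0 ≤ δ)
    (hJ : IsStory J) (hξ : ξ ≠ 0) (h : Path Θ δ J z (unit ξ) T x V) {t m : ℝ} (hm : 0 ≤ m)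
    (hmt : m ≤ 2 * t - T / ‖ξ‖) : m ^ 3 ≤ |hessianDet (actionPhase Θ δ y J x t) ξ| := by
  obtain ⟨Z, T', hS⟩ := exists_smoothDir hΘ hδ hξ hJ h
  obtain ⟨V', hV'⟩ := hS.path.self_of_nhds
  obtain ⟨-, eT, -⟩ := hV'.unique hδ h (norm_unit hξ)
  set S := actionPhase Θ δ y J x t with hSdef
  have hSC : ContDiffAt ℝ ∞ S ξ := SmoothDir.contDiffAt hΘ hδ hJ hξ hS t
  have hZ := hS.start.differentiableAt (n := ∞) (by simp)
  have hT := hS.length.differentiableAt (n := ∞) (by simp)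
  have hu := (contDiffAt_unit hξ).differentiableAt (n := ∞) (by simp)
  set Q : Space → Space := fun η => Z η + T' η • unit η with hQ
  have hQd : HasFDerivAt Q (fderiv ℝ Q ξ) ξ := (hZ.add (hT.smul hu)).hasFDerivAt
  have hgrad : ∀ᶠ η in 𝓝 ξ, HasGradientAt S (Q η - y - (2 * t) • η) η := by
    have h1 : ∀ᶠ η in 𝓝 ξ, ContDiffAt ℝ 1 Z η := (hS.start.of_le (by simp)).eventually (by simp)
    have h2 : ∀ᶠ η in 𝓝 ξ, ContDiffAt ℝ 1 T' η :=
      (hS.length.of_le (by simp)).eventually (by simp)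
    filter_upwards [h1, h2, hS.path.eventually_nhds, isOpen_ne.mem_nhds hξ] with η k1 k2 k3 k4
    exact hasGradientAt_actionPhase hΘ hδ hJ k4 (k1.differentiableAt (by simp))
      (k2.differentiableAt (by simp)) k3 t
  have hfd : HasFDerivAt (fun η => Q η - y - (2 * t) • η)
      (fderiv ℝ Q ξ - (2 * t) • ContinuousLinearMap.id ℝ Space) ξ :=
    (hQd.sub_const y).sub ((hasFDerivAt_id ξ).const_smul (2 * t))
  have hhess : ∀ e f : Space, fderiv ℝ (fun η => fderiv ℝ S η f) ξ e
      = inner ℝ (fderiv ℝ Q ξ e - (2 * t) • e) f := by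
    intro e f
    have h1 : (fun η => fderiv ℝ S η f) =ᶠ[𝓝 ξ] fun η => inner ℝ (Q η - y - (2 * t) • η) f := by
      filter_upwards [hgrad] with η hη
      rw [hη.hasFDerivAt.fderiv, InnerProductSpace.toDual_apply_apply]
    rw [h1.fderiv_eq, (hfd.inner ℝ (hasFDerivAt_const f ξ)).fderiv]
    simp
  have hsymm : ∀ e f : Space, fderiv ℝ (fun η => fderiv ℝ S η f) ξ e
      = fderiv ℝ (fun η => fderiv ℝ S η e) ξ f := by
    have h1 : DifferentiableAt ℝ (fderiv ℝ S) ξ :=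
      (hSC.fderiv_right (m := ∞) (by simp)).differentiableAt (by simp)
    have h2 : IsSymmSndFDerivAt ℝ S ξ := hSC.isSymmSndFDerivAt (by
      rw [minSmoothness_of_isRCLikeNormedField]; exact WithTop.coe_le_coe.2 (le_top (a := (2 : ℕ∞))))
    intro e f
    rw [fderiv_clm_apply h1 (differentiableAt_const f),
      fderiv_clm_apply h1 (differentiableAt_const e)]
    simpa using h2.eq e f
  set A : Matrix (Fin 3) (Fin 3) ℝ := Matrix.of fun i j : Fin 3 =>
    -fderiv ℝ (fun η => fderiv ℝ S η (EuclideanSpace.single j 1)) ξ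
      (EuclideanSpace.single i 1) with hA
  have hdet : hessianDet S ξ = -A.det := by
    have h1 : A = -Matrix.of fun i j : Fin 3 =>
        fderiv ℝ (fun η => fderiv ℝ S η (EuclideanSpace.single j 1)) ξ
          (EuclideanSpace.single i 1) := by ext i j; simp [hA]
    rw [h1, Matrix.det_neg, hessianDet]
    norm_num
  rw [hdet, abs_neg]
  refine le_trans (pow_le_det_of_le ?_ hm ?_) (le_abs_self _)
  · ext i j
    simp only [Matrix.conjTranspose_apply, hA, Matrix.of_apply, star_trivial]
    rw [hsymm]
  · intro v
    have hv : v = ∑ i, v i • EuclideanSpace.single i (1 : ℝ) := by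
      ext i; simp [Fin.sum_univ_three]; fin_cases i <;> simp
    have h1 : dotProduct ⇑v (A.mulVec v) = -inner ℝ (fderiv ℝ Q ξ v - (2 * t) • v) v := by
      conv_rhs => rw [hv]
      simp only [map_sum, map_smul, Finset.smul_sum, ← Finset.sum_sub_distrib, sum_inner,
        inner_sum, inner_smul_right]
      simp only [dotProduct, Matrix.mulVec, hA, Matrix.of_apply, hhess, Finset.mul_sum,
        ← Finset.sum_neg_distrib]
      refine Finset.sum_congr rfl fun i _ => Finset.sum_congr rfl fun j _ => ?_
      have h2 := (hhess (.single i 1) (.single j 1)).symm.trans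
        ((hsymm _ _).trans (hhess (.single j 1) (.single i 1)))
      rw [smul_comm (2 * t), ← smul_sub, inner_smul_left, conj_trivial, h2]
      ring
    rw [h1, inner_sub_left, inner_smul_left, real_inner_self_eq_norm_sq, conj_trivial]
    have h2 := inner_fderiv_start_le hδ hξ hZ hT (eT ▸ h.nonneg) hS.path v
    rw [← hQ, eT] at h2
    nlinarith [mul_le_mul_of_nonneg_right hmt (sq_nonneg ‖v‖)]

end TwoObstacles

/-! ### Propagation of the amplitudes -/

namespace TwoObstacles

open Filter Topology

variable {Θ : Fin 2 → Obstacle} {δ : ℝ} {J : List (Fin 2)} {j : Fin 2}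
  {y z v x p V W ξ : Space} {T : ℝ}

/-- A nonnegative coefficient makes `‖f‖ ^ 2` decrease. No bound on `a` is needed, hence no control
of the Laplacian of the phase at the reflection point. -/
theorem eq_zero_of_damped {f : ℝ → ℂ} {a : ℝ → ℝ} {s t : ℝ} (hst : s ≤ t)
    (hc : ContinuousOn f (Set.Icc s t)) (h0 : f s = 0)
    (hd : ∀ r ∈ Set.Ioo s t, HasDerivAt f (-((a r : ℂ) * f r)) r)
    (ha : ∀ r ∈ Set.Ioo s t, 0 ≤ a r) : f t = 0 := by
  have hsq : ∀ r ∈ Set.Ioo s t,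
      HasDerivAt (fun r => ‖f r‖ ^ 2) (2 * inner ℝ (f r) (-((a r : ℂ) * f r))) r :=
    fun r hr => (hd r hr).norm_sq
  have hanti : AntitoneOn (fun r => ‖f r‖ ^ 2) (Set.Icc s t) := by
    refine antitoneOn_of_deriv_nonpos (convex_Icc s t) (hc.norm.pow 2) ?_ ?_
    · rw [interior_Icc]
      exact fun r hr => (hsq r hr).differentiableAt.differentiableWithinAt
    · rw [interior_Icc]
      intro r hr
      rw [(hsq r hr).deriv, inner_neg_right, ← Complex.real_smul, inner_smul_right]
      have := mul_nonneg (ha r hr) (real_inner_self_nonneg (x := f r))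
      linarith
  have h1 := hanti (Set.left_mem_Icc.2 hst) (Set.right_mem_Icc.2 hst) hst
  simp only [h0, norm_zero] at h1
  have h2 : ‖f t‖ ^ 2 = 0 := le_antisymm (by simpa using h1) (by positivity)
  simpa using h2

theorem isClosed_boundary (Θ : Obstacle) : IsClosed Θ.boundary :=
  isClosed_eq Θ.smooth.continuous continuous_const

theorem OffLast.eventually (hx : OffLast Θ J x) : ∀ᶠ x' in 𝓝 x, OffLast Θ J x' := by
  cases h : J.getLast? with
  | none => exact Eventually.of_forall fun x' i hi => by simp [h] at hi
  | some i =>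
    filter_upwards [(isClosed_boundary (Θ i)).isOpen_compl.mem_nhds (hx i h)] with x' hx' k hk
    obtain rfl : i = k := by simpa [h] using hk
    exact hx'

section

variable {φ : Phase} (hΘ : Disjoint (Θ 0).carrier (Θ 1).carrier) (hδ : 0 ≤ δ) (hξ : ξ ≠ 0)

include hΘ hδ hξ

/-- The phases are convex along their wave fronts. -/
theorem IsRayPhase.laplacian_nonneg (hφ : IsRayPhase Θ δ y J ξ φ) (hJ : IsStory J)
    (h : Path Θ δ J z (unit ξ) T x V) (hx : OffLast Θ J x) :
    0 ≤ Laplacian.laplacian φ.val x := by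
  obtain ⟨Z, T', V', hS⟩ := exists_smoothPath hΘ hδ hJ hξ h hx
  rw [InnerProductSpace.laplacian_eq_iteratedFDeriv_stdOrthonormalBasis]
  refine Finset.sum_nonneg fun i _ => ?_
  rw [iteratedFDeriv_two_apply]
  set e := stdOrthonormalBasis ℝ Space i
  have hV : DifferentiableAt ℝ (fun x' => V' (x', ξ)) x :=
    (contDiffAt_left hS.dir).differentiableAt (by simp)
  have hφd : DifferentiableAt ℝ (fderiv ℝ φ.val) x :=
    ((hφ.contDiffAt hΘ hδ hξ hJ h hx).fderiv_right (m := ∞) (by simp)).differentiableAt (by simp)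
  have hgrad : (fun x' => fderiv ℝ φ.val x' e) =ᶠ[𝓝 x] fun x' => inner ℝ (V' (x', ξ)) e := by
    filter_upwards [hS.eventually_path, hx.eventually] with x' h1 h2
    rw [(hφ.hasGradientAt hΘ hδ hξ hJ h1 h2).hasFDerivAt.fderiv,
      InnerProductSpace.toDual_apply_apply]
  have hsnd : fderiv ℝ (fderiv ℝ φ.val) x e e = inner ℝ (fderiv ℝ (fun x' => V' (x', ξ)) x e) e := by
    have h1 := fderiv_clm_apply hφd (differentiableAt_const e)
    rw [hgrad.fderiv_eq, (hV.hasFDerivAt.inner ℝ (hasFDerivAt_const e x)).fderiv] at h1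
    simpa using (DFunLike.congr_fun h1 e).symm
  have hline : HasDerivAt (fun s : ℝ => -V' (x + s • e, ξ))
      (-fderiv ℝ (fun x' => V' (x', ξ)) x e) 0 := by
    have h1 : HasFDerivAt (fun x' => V' (x', ξ)) (fderiv ℝ (fun x' => V' (x', ξ)) x)
        (x + (0 : ℝ) • e) := by simpa using hV.hasFDerivAt
    exact (h1.comp_hasDerivAt 0 (hasDerivAt_add_smul x e 0)).neg
  have htend : Tendsto (fun s : ℝ => x + s • e) (𝓝 0) (𝓝 x) := by
    simpa using (hasDerivAt_add_smul x e 0).continuousAt.tendsto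
  -- Rays with equal initial direction have monotone final velocities, so the Hessian of the phase
  -- is nonnegative in every direction.
  have h2 := inner_deriv_le (k := fun _ => 0) hline (hasDerivAt_add_smul x e 0)
    continuousAt_const (by
      filter_upwards [htend.eventually hS.eventually_path] with s hs
      have h3 := hS.path.self_of_nhds.ray.inner_sub_sub_le hδ hs.ray (norm_unit hξ)
        (norm_unit hξ)
      simp only [sub_self, inner_zero_right, zero_smul, add_zero, zero_mul] at h3 ⊢
      rw [real_inner_comm] at h3
      rw [neg_sub_neg, ← neg_sub (V' (x + s • e, ξ)), inner_neg_left]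
      linarith)
  rw [inner_neg_left, zero_mul] at h2
  have h3 : 0 ≤ fderiv ℝ (fderiv ℝ φ.val) x e e := by rw [hsnd]; linarith
  simpa using h3

variable {q : Space → Space → ℂ} {w : ℕ → List (Fin 2) → Space → ℝ → Space → ℂ} {k : ℕ} {t : ℝ}

/-- An amplitude vanishes at the end of a ray if it vanishes at its beginning, and the source in
the transport equation vanishes on the ray. -/
theorem IsAmplitude.eq_zero_of_transport (hw : IsAmplitude Θ δ y q w) (hJ : IsStory J) {s₀ : ℝ}
    (hs₀ : 0 ≤ s₀) (hst : s₀ ≤ t)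
    (hpath : ∀ s ∈ Set.Icc s₀ t, ∃ z T,
      Path Θ δ J z (unit ξ) T (x - (2 * ‖ξ‖ * (t - s)) • V) V)
    (hoff : ∀ s ∈ Set.Ioo s₀ t, OffLast Θ J (x - (2 * ‖ξ‖ * (t - s)) • V))
    (hsource : ∀ s ∈ Set.Ioo s₀ t, transport (phase Θ δ y J ξ).val ξ (fun z s => w k J z s ξ)
      (x - (2 * ‖ξ‖ * (t - s)) • V) s = 0)
    (hzero : w k J (x - (2 * ‖ξ‖ * (t - s₀)) • V) s₀ ξ = 0) : w k J x t ξ = 0 := by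
  have hφ := isRayPhase (y := y) hΘ hδ hξ hJ
  set X : ℝ → Space := fun s => x - (2 * ‖ξ‖ * (t - s)) • V with hX
  have hXd : ∀ s, HasDerivAt X ((2 * ‖ξ‖) • V) s := by
    intro s
    have h1 := ((((hasDerivAt_id s).const_sub t).const_mul (2 * ‖ξ‖)).smul_const V).const_sub x
    exact h1.congr_deriv (by module)
  have hXc : Continuous X := by rw [hX]; fun_prop
  suffices h : w k J (X t) t ξ = 0 by simpa [hX] using h
  refine eq_zero_of_damped (f := fun s => w k J (X s) s ξ)
    (a := fun s => ‖ξ‖ * Laplacian.laplacian (phase Θ δ y J ξ).val (X s)) hst ?_ hzero ?_ ?_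
  · refine (hw.continuous k J ξ hJ hξ).comp (f := fun s => (X s, s))
      (hXc.prodMk continuous_id).continuousOn ?_
    intro s hs
    exact ⟨(hφ.mem_dom_iff _).2 (by obtain ⟨z, T, h⟩ := hpath s hs; exact ⟨z, T, V, h⟩), hs₀.trans hs.1⟩
  · intro s hs
    obtain ⟨z, T, hp⟩ := hpath s ⟨hs.1.le, hs.2.le⟩
    have hint := hφ.mem_interior hΘ hδ hξ hJ hp (hoff s hs)
    have hs0 : 0 < s := hs₀.trans_lt hs.1
    set F : Space × ℝ → ℂ := fun b => w k J b.1 b.2 ξ with hF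
    have hFd : HasFDerivAt F (fderiv ℝ F (X s, s)) (X s, s) :=
      (((hw.smooth k J ξ hJ hξ).contDiffAt ((isOpen_interior.prod isOpen_Ioi).mem_nhds
        (Set.mk_mem_prod hint hs0))).differentiableAt (by simp)).hasFDerivAt
    have h1 : HasDerivAt (fun s => w k J (X s) s ξ) (fderiv ℝ F (X s, s) ((2 * ‖ξ‖) • V, 1)) s :=
      hFd.comp_hasDerivAt (f := fun s => (X s, s)) s ((hXd s).prodMk (hasDerivAt_id s))
    have h2 : HasDerivAt (fun s' => w k J (X s) s' ξ) (fderiv ℝ F (X s, s) (0, 1)) s :=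
      hFd.comp_hasDerivAt (f := fun s' => (X s, s')) s
        ((hasDerivAt_const s (X s)).prodMk (hasDerivAt_id s))
    have h3 : HasFDerivAt (fun x' => w k J x' s ξ)
        ((fderiv ℝ F (X s, s)).comp (ContinuousLinearMap.inl ℝ Space ℝ)) (X s) :=
      hFd.comp (f := fun x' => (x', s)) (X s) (hasFDerivAt_prodMk_left (X s) s)
    have h4 := hsource s hs
    rw [transport, h2.deriv, h3.fderiv, hφ.gradient_eq hΘ hδ hξ hJ hp (hoff s hs)] at h4
    refine h1.congr_deriv ?_
    have h5 : (((2 * ‖ξ‖) • V, 1) : Space × ℝ) = (2 * ‖ξ‖) • (V, 0) + (0, 1) := by simp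
    rw [h5, map_add, map_smul, Complex.real_smul]
    simp only [ContinuousLinearMap.comp_apply, ContinuousLinearMap.inl_apply] at h4
    linear_combination h4
  · intro s hs
    obtain ⟨z, T, hp⟩ := hpath s ⟨hs.1.le, hs.2.le⟩
    exact mul_nonneg (norm_nonneg _) (hφ.laplacian_nonneg hΘ hδ hξ hJ hp (hoff s hs))

/-- The backward ray of `(x, t)` does not meet `K` at time zero. -/
def AvoidsAt (K : Set Space) (ξ z : Space) (T t : ℝ) : Prop :=
  2 * ‖ξ‖ * t < T ∨ z + T • unit ξ - (2 * t) • ξ ∉ K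

-- Moving back along the ray changes neither the point occupied at time zero nor the alternative
-- concerning its length.
omit hΘ hδ hξ in
theorem AvoidsAt.sub {K : Set Space} (hξ : ξ ≠ 0) (h : AvoidsAt K ξ z T t) (s : ℝ) :
    AvoidsAt K ξ z (T - 2 * ‖ξ‖ * (t - s)) s := by
  have h1 : (2 * ‖ξ‖ * (t - s)) • unit ξ = (2 * (t - s)) • ξ := by
    rw [mul_right_comm, mul_smul, norm_smul_unit hξ]
  have h2 : z + (T - 2 * ‖ξ‖ * (t - s)) • unit ξ - (2 * s) • ξ
      = z + T • unit ξ - (2 * t) • ξ := by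
    rw [sub_smul, h1]; module
  exact h.imp (fun h => by linarith) fun h => by rwa [h2]

/-- The source involves the Laplacian of the preceding coefficient, so vanishing on a single ray
would not suffice. As `K` is closed, nearby rays avoid it too, and that coefficient vanishes in a
neighbourhood. -/
theorem IsAmplitude.transport_eq_zero (hw : IsAmplitude Θ δ y q w) (hJ : IsStory J) {K : Set Space}
    (hK : IsClosed K)
    (ih : ∀ l < k, ∀ x z T V t, 0 ≤ t → Path Θ δ J z (unit ξ) T x V → AvoidsAt K ξ z T t →
      w l J x t ξ = 0)
    (ht : 0 < t) (h : Path Θ δ J z (unit ξ) T x V) (hx : OffLast Θ J x)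
    (hz : AvoidsAt K ξ z T t) :
    transport (phase Θ δ y J ξ).val ξ (fun z s => w k J z s ξ) x t = 0 := by
  have hφ := isRayPhase (y := y) hΘ hδ hξ hJ
  have hint := hφ.mem_interior hΘ hδ hξ hJ h hx
  cases k with
  | zero => exact hw.transport_zero J ξ hJ hξ x hint t ht
  | succ k =>
    rw [hw.transport_succ k J ξ hJ hξ x hint t ht]
    obtain ⟨Z, T', V', hS⟩ := exists_smoothPath hΘ hδ hJ hξ h hx
    obtain ⟨eZ, eT, -⟩ := hS.eq hδ hξ h
    have hZc := (contDiffAt_left hS.start).continuousAt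
    have hTc := (contDiffAt_left hS.length).continuousAt
    have hav : ∀ᶠ x' in 𝓝 x, AvoidsAt K ξ (Z (x', ξ)) (T' (x', ξ)) t := by
      rcases hz with hz | hz
      · filter_upwards [continuousAt_const.eventually_lt hTc (by simpa only [eT] using hz)]
          with x' hx' using Or.inl hx'
      · have hc : ContinuousAt (fun x' => Z (x', ξ) + T' (x', ξ) • unit ξ - (2 * t) • ξ) x :=
          (hZc.add (hTc.smul continuousAt_const)).sub continuousAt_const
        filter_upwards [hc.eventually (hK.isOpen_compl.mem_nhds
          (by show Z (x, ξ) + T' (x, ξ) • unit ξ - (2 * t) • ξ ∈ Kᶜ; rw [eZ, eT]; exact hz))] with x' hx' using Or.inr hx'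
    have hev : (fun x' => w k J x' t ξ) =ᶠ[𝓝 x] fun _ => 0 := by
      filter_upwards [hS.eventually_path, hav] with x' h1 h2
      exact ih k (Nat.lt_succ_self k) x' _ _ _ t ht.le h1 h2
    rw [(InnerProductSpace.laplacian_congr_nhds hev).eq_of_nhds]
    simp

omit hΘ hξ in
theorem Path.snoc_forward {τ τ' : ℝ} (h1 : Path Θ δ J z (unit ξ) (T - τ) p W)
    (hp : p ∈ (Θ j).boundary) (hW : δ < -inner ℝ ((Θ j).normal p) W)
    (hV : V = (Θ j).bounce p W) (hτ : 0 ≤ τ') :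
    Path Θ δ (J ++ [j]) z (unit ξ) (T - τ + τ') (p + τ' • V) V ∧
      (0 < τ' → OffLast Θ (J ++ [j]) (p + τ' • V)) := by
  refine ⟨path_snoc_iff.2 ⟨p, W, τ', hτ, by rwa [add_sub_cancel_right], hp, hW, hV, rfl⟩, ?_⟩
  intro hτ i hi hmem
  obtain rfl : j = i := by simpa using hi
  have h2 := (Θ j).inner_normal_sub_nonpos hp ((Θ j).boundary_subset_carrier hmem)
  have h3 : inner ℝ ((Θ j).normal p) V = -inner ℝ ((Θ j).normal p) W := by
    rw [hV, real_inner_comm, (Θ j).inner_bounce, (Θ j).inner_normal_normal hp,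
      real_inner_comm W]
    ring
  rw [add_sub_cancel_left, inner_smul_right, h3] at h2
  nlinarith

/-- Amplitudes propagate along the rays. -/
theorem IsAmplitude.eq_zero (hw : IsAmplitude Θ δ y q w) (hJ : IsStory J) {K : Set Space}
    (hK : IsClosed K) (hq : ∀ x ∉ K, q x ξ = 0) (ht : 0 ≤ t)
    (h : Path Θ δ J z (unit ξ) T x V) (hz : AvoidsAt K ξ z T t) : w k J x t ξ = 0 := by
  have hr : 0 < ‖ξ‖ := norm_pos_iff.2 hξ
  induction J using List.reverseRecOn generalizing k x z T V t with
  | nil =>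
    induction k using Nat.strong_induction_on generalizing x z T V t with
    | _ k ih =>
      obtain ⟨rfl, rfl, rfl⟩ := h
      have hz' : x - (2 * t) • ξ ∉ K := by
        rcases hz with hz | hz
        · nlinarith
        · simpa using hz
      have hX : ∀ s, x - (2 * ‖ξ‖ * (t - s)) • unit ξ = x - (2 * (t - s)) • ξ := by
        intro s
        rw [mul_right_comm, mul_smul, norm_smul_unit hξ]
      refine hw.eq_zero_of_transport hΘ hδ hξ hJ le_rfl ht (V := unit ξ)
        (fun s _ => ⟨_, 0, rfl, rfl, rfl⟩) (fun s _ i hi => by simp at hi) (fun s hs => ?_) ?_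
      · refine hw.transport_eq_zero hΘ hδ hξ hJ hK
          (fun l hl x z T V t ht h hz => ih l hl ht h hz) hs.1
          (V := unit ξ) ⟨rfl, rfl, rfl⟩ (fun i hi => by simp at hi) (Or.inr ?_)
        have hs : x - (2 * (t - s)) • ξ + (0 : ℝ) • unit ξ - (2 * s) • ξ = x - (2 * t) • ξ := by
          module
        rwa [hX, hs]
      · rw [hX]
        cases k with
        | zero =>
          rw [hw.initial_nil_zero _ _ hξ, hq]
          simpa using hz'
        | succ k => exact hw.initial_nil_succ k _ _ hξ
  | append_singleton J j ihJ =>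
    induction k using Nat.strong_induction_on generalizing x z T V t with
    | _ k ih =>
      obtain ⟨p, W, τ, h0, h1, hp, hW, hV, hxp⟩ := path_snoc_iff.1 h
      have hJ' := (isStory_snoc_iff.1 hJ).1
      have hX : ∀ s, x - (2 * ‖ξ‖ * (t - s)) • V = p + (τ - 2 * ‖ξ‖ * (t - s)) • V := by
        intro s
        rw [hxp, sub_smul]; abel
      have hτ : τ = 2 * ‖ξ‖ * (τ / (2 * ‖ξ‖)) := by field_simp
      have hpos : ∀ s, max 0 (t - τ / (2 * ‖ξ‖)) ≤ s → 0 ≤ τ - 2 * ‖ξ‖ * (t - s) := by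
        intro s hs
        have h2 := (le_max_right _ _).trans hs
        nlinarith
      have hpos' : ∀ s, max 0 (t - τ / (2 * ‖ξ‖)) < s → 0 < τ - 2 * ‖ξ‖ * (t - s) := by
        intro s hs
        have h2 := (le_max_right _ _).trans_lt hs
        nlinarith
      have hT : ∀ s, T - τ + (τ - 2 * ‖ξ‖ * (t - s)) = T - 2 * ‖ξ‖ * (t - s) := fun s => by ring
      have hfw := fun s hs => h1.snoc_forward hδ hp hW hV (hpos s hs)
      simp only [hT] at hfw
      -- Since the speed is `2‖ξ‖`, the last reflection occurs at time `t - τ / (2‖ξ‖)`; the ray is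
      -- followed back to it, or to time zero if that comes first.
      refine hw.eq_zero_of_transport hΘ hδ hξ hJ (le_max_left 0 (t - τ / (2 * ‖ξ‖)))
        (max_le ht (by have : 0 ≤ τ / (2 * ‖ξ‖) := by positivity
                       linarith)) (V := V) (fun s hs => ?_) (fun s hs => ?_) (fun s hs => ?_) ?_
      · rw [hX]
        exact ⟨_, _, (hfw s hs.1).1⟩
      · rw [hX]
        exact (hfw s hs.1.le).2 (hpos' s hs.1)
      · rw [hX]
        exact hw.transport_eq_zero hΘ hδ hξ hJ hK
          (fun l hl x z T V t ht h hz => ih l hl ht h hz) ((le_max_left _ _).trans_lt hs.1)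
          (hfw s hs.1.le).1 ((hfw s hs.1.le).2 (hpos' s hs.1)) (hz.sub hξ s)
      -- Either the zero initial data apply, or the boundary condition passes to the shorter story.
      · rcases le_total (t - τ / (2 * ‖ξ‖)) 0 with hneg | hnn
        · have h2 := (hfw _ le_rfl).1
          rw [← hX, max_eq_left hneg] at h2
          rw [max_eq_left hneg]
          exact hw.initial k _ ξ hJ (by simp) hξ _
            (((isRayPhase hΘ hδ hξ hJ).mem_dom_iff _).2 ⟨_, _, _, h2⟩)
        · have h2 : 2 * ‖ξ‖ * (t - (t - τ / (2 * ‖ξ‖))) = τ := by rw [sub_sub_cancel, ← hτ]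
          rw [max_eq_right hnn, hX, h2, sub_self, zero_smul, add_zero,
            hw.boundary k J j ξ hJ hξ p ((isRayPhase hΘ hδ hξ hJ').mem_incoming hΘ hδ hξ hJ h1 hp hW)
              _ hnn]
          have h3 := hz.sub hξ (t - τ / (2 * ‖ξ‖))
          rw [h2] at h3
          exact ihJ hJ' hnn h1 h3

end

end TwoObstacles

/-! ### Support of the amplitudes and uniform non-degeneracy -/

namespace TwoObstacles

open Filter Topology

variable {Θ : Fin 2 → Obstacle} {δ : ℝ} {J : List (Fin 2)} {j : Fin 2}
  {y z x V ξ : Space} {T t α₀ β₀ δ₀ : ℝ} {q : Space → Space → ℂ}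
  {w : ℕ → List (Fin 2) → Space → ℝ → Space → ℂ}

/-- Where the amplitude does not vanish, the ray started, at time zero, in the support of the
symbol. -/
theorem AmplitudeNonzero.start_mem (hΘ : Disjoint (Θ 0).carrier (Θ 1).carrier) (hδ : 0 ≤ δ)
    (hξ : ξ ≠ 0) (hw : IsAmplitude Θ δ y q w) (hJ : IsStory J) (ht : 0 ≤ t)
    (h : Path Θ δ J z (unit ξ) T x V) (hne : AmplitudeNonzero w J x t ξ) :
    T ≤ 2 * ‖ξ‖ * t ∧ z + T • unit ξ - (2 * t) • ξ ∈ closure {x | q x ξ ≠ 0} := by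
  obtain ⟨k, hk⟩ := hne
  by_contra hc
  rw [not_and_or, not_le] at hc
  exact hk (hw.eq_zero hΘ hδ hξ hJ isClosed_closure
    (fun x hx => by_contra fun h => hx (subset_closure h)) ht h hc)

theorem AmplitudeNonzero.not_isBehind (hΘ : Disjoint (Θ 0).carrier (Θ 1).carrier) (hδ : 0 ≤ δ)
    (hw : IsAmplitude Θ δ y q w) (hJ : IsStory J) (ht : 0 < t)
    (hc : IsCritical Θ δ y J x t ξ) (hne : AmplitudeNonzero w J x t ξ) : ¬ IsBehind Θ J y ξ := by
  obtain ⟨h0, z, T, V, h⟩ := (mem_frequencies_iff hΘ hδ hJ).1 hc.1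
  have h1 := (isCritical_iff hΘ hδ hJ h0 h t).1 hc
  have h2 := (hne.start_mem hΘ hδ h0 hw hJ ht.le h).1
  cases J with
  | nil => exact not_isBehind_nil
  | cons j J =>
    -- The nonvanishing amplitude makes this coefficient nonnegative, so the first reflection point
    -- lies ahead of `y`.
    have hz : z = y + (2 * t * ‖ξ‖ - T) • unit ξ := by
      rw [sub_smul, mul_smul, norm_smul_unit h0, ← add_sub_assoc, ← h1, add_sub_cancel_right]
    obtain ⟨h3, h4, -⟩ := h
    rw [hz] at h3 h4
    exact TwoObstacles.not_isBehind h0 (by linarith) h3 (by linarith)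

theorem IsSymbol.of_mem_closure (hq : IsSymbol Θ α₀ β₀ δ₀ q) (hx : x ∈ closure {x | q x ξ ≠ 0}) :
    ‖ξ‖ ≤ β₀ ∧ δ₀ ≤ Metric.infDist x ((Θ 0).carrier ∪ (Θ 1).carrier) := by
  obtain ⟨x', hx'⟩ := closure_nonempty_iff.1 ⟨x, hx⟩
  refine ⟨(hq.frequency x' ξ hx').2, ?_⟩
  exact closure_minimal (t := {x | δ₀ ≤ Metric.infDist x ((Θ 0).carrier ∪ (Θ 1).carrier)})
    (fun x hx => hq.away x ξ hx)
    (isClosed_le continuous_const (Metric.continuous_infDist_pt _)) hx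

theorem AmplitudeNonzero.pow_le_hessianDet (hΘ : Disjoint (Θ 0).carrier (Θ 1).carrier)
    (hδ : 0 ≤ δ) (hβ : 0 < β₀) (hδ₀ : 0 < δ₀) (hq : IsSymbol Θ α₀ β₀ δ₀ q)
    (hw : IsAmplitude Θ δ y q w) (hJ : IsStory J) {t₀ : ℝ} (ht₀ : 0 < t₀) (ht : t₀ ≤ t)
    (hξ : ξ ∈ frequencies Θ δ y J x) (hne : AmplitudeNonzero w J x t ξ) :
    min (δ₀ / β₀) (2 * t₀) ^ 3 ≤ |hessianDet (actionPhase Θ δ y J x t) ξ| := by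
  obtain ⟨h0, z, T, V, h⟩ := (mem_frequencies_iff hΘ hδ hJ).1 hξ
  refine TwoObstacles.pow_le_hessianDet hΘ hδ hJ h0 h (by positivity) ?_
  obtain ⟨h1, h2⟩ := hne.start_mem hΘ hδ h0 hw hJ (ht₀.le.trans ht) h
  have hr : 0 < ‖ξ‖ := norm_pos_iff.2 h0
  cases J with
  | nil =>
    rw [h.1, zero_div, sub_zero]
    exact (min_le_right _ _).trans (by linarith)
  | cons j J =>
    refine (min_le_left _ _).trans ?_
    obtain ⟨h3, h4⟩ := hq.of_mem_closure h2
    have hz : z ∈ (Θ 0).carrier ∪ (Θ 1).carrier := by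
      have h5 := (Θ j).boundary_subset_carrier h.1
      fin_cases j
      · exact Or.inl h5
      · exact Or.inr h5
    have h5 := h4.trans (Metric.infDist_le_dist_of_mem hz)
    -- The starting point in the closed support of the symbol and the reflection point `z` are at
    -- distance `2‖ξ‖t - T`, which is therefore at least `δ₀`.
    have h6 : z + T • unit ξ - (2 * t) • ξ - z = -((2 * ‖ξ‖ * t - T) • unit ξ) := by
      have h7 : (2 * t) • ξ = (2 * ‖ξ‖ * t) • unit ξ := by
        rw [mul_right_comm, mul_smul (2 * t), norm_smul_unit h0]
      rw [h7]; module
    rw [dist_eq_norm, h6, norm_neg, norm_smul, norm_unit h0, mul_one, Real.norm_eq_abs,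
      abs_of_nonneg (by linarith)] at h5
    calc δ₀ / β₀ ≤ δ₀ / ‖ξ‖ := by gcongr
      _ ≤ (2 * ‖ξ‖ * t - T) / ‖ξ‖ := by gcongr
      _ = 2 * t - T / ‖ξ‖ := by field_simp

end TwoObstacles

theorem lemma4p9 (Θ : Fin 2 → Obstacle) (hΘ : Disjoint (Θ 0).carrier (Θ 1).carrier)
    (δ₁ : ℝ) (hδ₁ : 0 ≤ δ₁) :
    -- critical points of the phase
    (∀ (y : Space) (J : List (Fin 2)), IsStory J → ∀ (x : Space) (t : ℝ), 0 < t →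
      (∀ ξ ∈ frequencies Θ δ₁ y J x, ContDiffAt ℝ ∞ (actionPhase Θ δ₁ y J x t) ξ) ∧
      {ξ | IsCritical Θ δ₁ y J x t ξ ∧ ¬ IsBehind Θ J y ξ}.Subsingleton ∧
      (∀ ξ ∈ frequencies Θ δ₁ y J x,
        (IsCritical Θ δ₁ y J x t ξ ∧ ¬ IsBehind Θ J y ξ) ↔ RayReaches Θ J y ξ (2 * t) x)) ∧
    ∀ α₀ β₀ δ₀ : ℝ, 0 < α₀ → 0 < β₀ → 0 < δ₀ →
      -- where the amplitude does not vanish, the critical points are of the above kind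
      (∀ (y : Space) (q : Space → Space → ℂ), IsSymbol Θ α₀ β₀ δ₀ q →
        ∀ w : ℕ → List (Fin 2) → Space → ℝ → Space → ℂ, IsAmplitude Θ δ₁ y q w →
        ∀ J : List (Fin 2), IsStory J → ∀ (x : Space) (t : ℝ), 0 < t →
          (∀ ξ, IsCritical Θ δ₁ y J x t ξ → AmplitudeNonzero w J x t ξ → ¬ IsBehind Θ J y ξ) ∧
          {ξ | IsCritical Θ δ₁ y J x t ξ ∧ AmplitudeNonzero w J x t ξ}.Subsingleton) ∧
      -- uniform non-degeneracy
      ∀ t₀ : ℝ, 0 < t₀ → ∃ c : ℝ, 0 < c ∧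
        ∀ (y : Space) (q : Space → Space → ℂ), IsSymbol Θ α₀ β₀ δ₀ q →
        ∀ w : ℕ → List (Fin 2) → Space → ℝ → Space → ℂ, IsAmplitude Θ δ₁ y q w →
        ∀ J : List (Fin 2), IsStory J → ∀ (x : Space) (t : ℝ), t₀ ≤ t →
        ∀ ξ ∈ frequencies Θ δ₁ y J x, AmplitudeNonzero w J x t ξ →
          c ≤ |hessianDet (actionPhase Θ δ₁ y J x t) ξ| := by
  refine ⟨fun y J hJ x t ht => ⟨fun ξ hξ => ?_, subsingleton_isCritical hΘ hδ₁ hJ ht,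
    fun ξ hξ => isCritical_and_not_isBehind_iff hΘ hδ₁ hJ ht hξ⟩, ?_⟩
  · obtain ⟨h0, z, T, V, h⟩ := (mem_frequencies_iff hΘ hδ₁ hJ).1 hξ
    obtain ⟨Z, T', hS⟩ := exists_smoothDir hΘ hδ₁ h0 hJ h
    exact hS.contDiffAt hΘ hδ₁ hJ h0 t
  · intro α₀ β₀ δ₀ _ hβ hδ₀
    refine ⟨fun y q _ w hw J hJ x t ht => ⟨fun ξ hc hne => hne.not_isBehind hΘ hδ₁ hw hJ ht hc,
      (subsingleton_isCritical hΘ hδ₁ hJ ht).anti fun ξ hξ =>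
        ⟨hξ.1, hξ.2.not_isBehind hΘ hδ₁ hw hJ ht hξ.1⟩⟩, fun t₀ ht₀ => ?_⟩
    -- The first entry serves non-empty stories, the second the empty one, where `T = 0`; the cube
    -- comes from three eigenvalues.
    exact ⟨min (δ₀ / β₀) (2 * t₀) ^ 3, by positivity, fun y q hq w hw J hJ x t ht ξ hξ hne =>
      hne.pow_le_hessianDet hΘ hδ₁ hβ hδ₀ hq hw hJ ht₀ ht hξ⟩
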